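/- **Setting.** Let $(X,\mathcal U)$ be a compact (Hausdorff) Kähler orbifold of complex dimension $n\ge 1$ with maximal atlas $\mathcal U$ of uniformising charts $(\tilde U,\Gamma,\varphi)$ ($\tilde U\subset\mathbb C^n$ open and connected, $\Gamma$ a finite group acting effectively on $\tilde U$ by biholomorphisms, $\varphi$ inducing a homeomorphism of $\tilde U/\Gamma$ onto an open subset of $X$). Let $D\subset X$ be a connected closed complex suborbifold of codimension one (around each point of $D$ there is a chart $\tilde U$ in which $\tilde D:=\varphi^{-1}(D\cap\varphi(\tilde U))$ is a complex submanifold of codimension one) that contains every singular point of $X$ (point with non-trivial isotropy group). A *defining function* of $D$ on a chart $\tilde U$ is a holomorphic function $\tilde s$ on $\tilde U$ with $\tilde D=\{\tilde s=0\}$ and $d\tilde s\neq 0$ along $\tilde D$; the charts that admit one form an atlas of $X$, and the corresponding $\tilde D$ form an atlas of the orbifold $D$. Let $K_X$, $K_D$ be the canonical orbibundles, $N_D^*$ the conormal orbibundle of $D$ in $X$ (fibre at $z\in\tilde D$: the covectors on $T_z\tilde U$ vanishing on $T_z\tilde D$), and $[D]$ the line orbibundle on $X$ given by the cocycle $f_k/(f_l\circ\lambda)$,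 where the $f_k$ are defining functions of $D$ on the charts $\tilde U_k$ and $\lambda:\tilde U_k\to\tilde U_l$ runs over the injections of charts. Tensor powers are written additively. **Assumptions.** Let $\alpha\in\mathbb N$, $\alpha\ge 2$, and suppose that 1. $-K_X\cong\alpha[D]$ as holomorphic line orbibundles on $X$; 2. (basic assumption) every point of $D$ lies in $\varphi(\tilde U)$ for some chart $(\tilde U,\Gamma,\varphi)$ of $X$ with holomorphic coordinates $(z_1,\dots,z_n)$ on $\tilde U$ in which $\tilde D=\{z_n=0\}$ and each $\gamma\in\Gamma$ acts as a matrix $\begin{pmatrix}A&\star\\0&a\end{pmatrix}$ with $A\in GL(n-1,\mathbb C)$ and $a^{\alpha-1}=\det A$. **Proposition.** There is an isomorphism of holomorphic line orbibundles on $D$ $$K_D\;\cong\;(\alpha-1)N_D^*.$$ More precisely: * There exists a trivialising (holomorphic, nowhere vanishing) section $\Omega$ of $K_{X\setminus D}$ that, as a section of $K_X$, blows up to order $\alpha$ along $D$; that is, on each of the above charts, for some defining function $\tilde s$ of $D$, the form $\tilde s^{\alpha}\varphi^*\Omega$ extends to a nowhere vanishing holomorphic $n$-form on $\tilde U$. *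 Each such $\Omega$ determines an isomorphism: there is exactly one isomorphism of holomorphic line orbibundles $\psi:(\alpha-1)N_D^*\to K_D$ that is given by the Poincaré residue of $\Omega$, i.e. such that, on each of the above charts, for every defining function $\tilde s$ of $D$ for which $\tilde s^\alpha\varphi^*\Omega$ extends holomorphically to $\tilde U$ and every $z\in\tilde D$, $$\psi\big(d\tilde s^{\otimes(\alpha-1)}|_z\big)=\Big((\tilde s^{\alpha}\varphi^*\Omega)\,\lrcorner\,\tfrac{\partial}{\partial\tilde s}\Big)\Big|_{T_z\tilde D},$$ where $\partial/\partial\tilde s$ is represented by any $v\in T_z\tilde U$ with $d\tilde s(v)=1$ and $(\eta\lrcorner v)=\eta(v,\cdot,\dots,\cdot)$. -/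

import Mathlib

open Filter Topology

namespace OrbiAdj

universe u

/-- The complex vector space `ℂⁿ`. -/
abbrev Cn (n : ℕ) : Type := Fin n → ℂ

/-! ### Complex orbifolds -/

/-- A (complex) uniformising chart `(Ũ, Γ, φ)` on `X`: `Ũ = dom` is a connected open subset of `ℂⁿ`
containing the origin, `Γ` is a finite group acting effectively on `Ũ` by biholomorphisms, and
`φ = proj : Ũ → X` is continuous and open and induces an injection (hence a homeomorphism onto an
open subset of `X`) on `Ũ / Γ`. The maps `act γ` and `proj` are total functions whose values outside
`dom` are irrelevant. -/
structure OrbiChart (X : Type u) [TopologicalSpace X] (n : ℕ) where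
  dom : Set (Cn n)
  isOpen_dom : IsOpen dom
  isConnected_dom : IsConnected dom
  zero_mem : (0 : Cn n) ∈ dom
  Γ : Type
  [group : Group Γ]
  [finite : Finite Γ]
  act : Γ → Cn n → Cn n
  act_mapsTo : ∀ γ, Set.MapsTo (act γ) dom dom
  act_one : ∀ x ∈ dom, act 1 x = x
  act_mul : ∀ γ δ, ∀ x ∈ dom, act (γ * δ) x = act γ (act δ x)
  act_holomorphic : ∀ γ, AnalyticOnNhd ℂ (act γ) dom
  effective : ∀ γ, (∀ x ∈ dom, act γ x = x) → γ = 1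
  proj : Cn n → X
  continuousOn_proj : ContinuousOn proj dom
  isOpen_image_proj : ∀ O ⊆ dom, IsOpen O → IsOpen (proj '' O)
  proj_eq_iff : ∀ x ∈ dom, ∀ y ∈ dom, proj x = proj y ↔ ∃ γ, act γ x = y

attribute [instance] OrbiChart.group OrbiChart.finite

/-- The open set `U = φ(Ũ)` of `X` covered by a chart. -/
def OrbiChart.range {X : Type u} [TopologicalSpace X] {n : ℕ} (c : OrbiChart X n) : Set X :=
  c.proj '' c.dom

/-- The preimage `φ⁻¹(D ∩ φ(Ũ)) ⊆ Ũ` of a subset `D` of `X`. -/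
def OrbiChart.preimage {X : Type u} [TopologicalSpace X] {n : ℕ} (c : OrbiChart X n) (D : Set X) :
    Set (Cn n) :=
  {x | x ∈ c.dom ∧ c.proj x ∈ D}

/-- `l` is an injection (embedding) of charts `(Ũ, Γ, φ) → (Ũ', Γ', φ')`: a holomorphic embedding
`Ũ → Ũ'` with `φ' ∘ l = φ`. (An injective immersion between open subsets of `ℂⁿ` is an open
embedding.) -/
structure IsInjection {X : Type u} [TopologicalSpace X] {n : ℕ} (c c' : OrbiChart X n)
    (l : Cn n → Cn n) : Prop where
  holomorphic : AnalyticOnNhd ℂ l c.dom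
  mapsTo : Set.MapsTo l c.dom c'.dom
  injOn : Set.InjOn l c.dom
  injective_fderiv : ∀ x ∈ c.dom, Function.Injective (fderiv ℂ l x)
  proj_comp : ∀ x ∈ c.dom, c'.proj (l x) = c.proj x

/-- Injections compose. -/
theorem IsInjection.comp {X : Type u} [TopologicalSpace X] {n : ℕ} {c c' c'' : OrbiChart X n}
    {l k : Cn n → Cn n} (hl : IsInjection c c' l) (hk : IsInjection c' c'' k) :
    IsInjection c c'' (k ∘ l) where
  holomorphic x hx := (hk.holomorphic _ (hl.mapsTo hx)).comp (hl.holomorphic x hx)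
  mapsTo := hk.mapsTo.comp hl.mapsTo
  injOn := hk.injOn.comp hl.injOn hl.mapsTo
  injective_fderiv x hx := by
    rw [fderiv_comp x (hk.holomorphic _ (hl.mapsTo hx)).differentiableAt
      (hl.holomorphic x hx).differentiableAt]
    exact (hk.injective_fderiv _ (hl.mapsTo hx)).comp (hl.injective_fderiv x hx)
  proj_comp x hx := by
    rw [Function.comp_apply, hk.proj_comp _ (hl.mapsTo hx), hl.proj_comp x hx]

/-- Each element of the local uniformising group is an injection of the chart into itself. Hence
compatibility with all injections, as required of orbibundles and of their sections and isomorphisms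
below, contains `Γ`-equivariance. -/
theorem isInjection_act {X : Type u} [TopologicalSpace X] {n : ℕ} (c : OrbiChart X n) (γ : c.Γ) :
    IsInjection c c (c.act γ) where
  holomorphic := c.act_holomorphic γ
  mapsTo := c.act_mapsTo γ
  injOn x hx y hy h := by
    have := congrArg (c.act γ⁻¹) h
    rwa [← c.act_mul _ _ x hx, ← c.act_mul _ _ y hy, inv_mul_cancel, c.act_one x hx,
      c.act_one y hy] at this
  injective_fderiv x hx := by
    have h1 : (c.act γ⁻¹ ∘ c.act γ) =ᶠ[𝓝 x] id := by
      filter_upwards [c.isOpen_dom.mem_nhds hx] with y hy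
      rw [Function.comp_apply, ← c.act_mul _ _ y hy, inv_mul_cancel, c.act_one y hy, id]
    have h2 := h1.fderiv_eq (𝕜 := ℂ)
    rw [fderiv_comp x (c.act_holomorphic γ⁻¹ _ (c.act_mapsTo γ hx)).differentiableAt
      (c.act_holomorphic γ x hx).differentiableAt, fderiv_id] at h2
    intro v w hvw
    have h3 := congrArg (fderiv ℂ (c.act γ⁻¹) (c.act γ x)) hvw
    rw [← ContinuousLinearMap.comp_apply, ← ContinuousLinearMap.comp_apply, h2] at h3
    simpa using h3
  proj_comp x hx := ((c.proj_eq_iff x hx _ (c.act_mapsTo γ hx)).2 ⟨γ, rfl⟩).symm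

/-- An orbifold atlas: the charts cover `X`, and any two charts are compatible near each point that
they both cover. -/
structure IsOrbifoldAtlas {X : Type u} [TopologicalSpace X] {n : ℕ} (A : Set (OrbiChart X n)) :
    Prop where
  covers : ∀ x : X, ∃ c ∈ A, x ∈ c.range
  compatible : ∀ c ∈ A, ∀ c' ∈ A, ∀ x ∈ c.range ∩ c'.range,
    ∃ c'' ∈ A, x ∈ c''.range ∧ (∃ l, IsInjection c'' c l) ∧ (∃ l', IsInjection c'' c' l')

/-- A complex orbifold structure of dimension `n` on `X`, given by its maximal orbifold atlas. -/
structure ComplexOrbifold (X : Type u) [TopologicalSpace X] (n : ℕ) where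
  atlas : Set (OrbiChart X n)
  isAtlas : IsOrbifoldAtlas atlas
  maximal : ∀ A : Set (OrbiChart X n), IsOrbifoldAtlas A → atlas ⊆ A → A ⊆ atlas

/-- The set `Sing(X)` of points with non-trivial isotropy group. -/
def ComplexOrbifold.singularSet {X : Type u} [TopologicalSpace X] {n : ℕ}
    (O : ComplexOrbifold X n) : Set X :=
  {p | ∃ c ∈ O.atlas, ∃ x ∈ c.dom, c.proj x = p ∧ ∃ γ : c.Γ, γ ≠ 1 ∧ c.act γ x = x}

/-- `g` is a Kähler metric on the orbifold: a smooth family of Hermitian (that is, positive definite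
symmetric real-bilinear and `J`-invariant) forms on each chart, for which all injections (in
particular the elements of the local uniformising groups) are isometries, and such that
`ω(v, w) = g(iv, w)` is closed. -/
structure ComplexOrbifold.IsKahlerMetric {X : Type u} [TopologicalSpace X] {n : ℕ}
    (O : ComplexOrbifold X n) (g : OrbiChart X n → Cn n → (Cn n →L[ℝ] Cn n →L[ℝ] ℝ)) : Prop where
  smooth : ∀ c ∈ O.atlas, ContDiffOn ℝ (⊤ : ℕ∞) (g c) c.dom
  symm : ∀ c ∈ O.atlas, ∀ x ∈ c.dom, ∀ v w, g c x v w = g c x w v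
  pos : ∀ c ∈ O.atlas, ∀ x ∈ c.dom, ∀ v, v ≠ 0 → 0 < g c x v v
  hermitian : ∀ c ∈ O.atlas, ∀ x ∈ c.dom, ∀ v w,
    g c x (Complex.I • v) (Complex.I • w) = g c x v w
  isometry : ∀ c ∈ O.atlas, ∀ c' ∈ O.atlas, ∀ l, IsInjection c c' l → ∀ x ∈ c.dom, ∀ v w,
    g c' (l x) (fderiv ℂ l x v) (fderiv ℂ l x w) = g c x v w
  closed : ∀ c ∈ O.atlas, ∀ x ∈ c.dom, ∀ a b e : Cn n,
    fderiv ℝ (fun y => g c y (Complex.I • b) e) x a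
      + fderiv ℝ (fun y => g c y (Complex.I • e) a) x b
      + fderiv ℝ (fun y => g c y (Complex.I • a) b) x e = 0

/-! ### Codimension-one suborbifolds -/

/-- `D` is a (closed) complex suborbifold of codimension one: around each of its points there is a
uniformising chart `Ũ` of `X` in which the preimage of `D` is a complex submanifold of codimension
one, that is, locally the zero set of a holomorphic function with non-vanishing differential. -/
structure ComplexOrbifold.IsSuborbifold {X : Type u} [TopologicalSpace X] {n : ℕ}
    (O : ComplexOrbifold X n) (D : Set X) : Prop where
  isClosed : IsClosed D
  exists_chart : ∀ p ∈ D, ∃ c ∈ O.atlas, p ∈ c.range ∧ ∀ x ∈ c.preimage D,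
    ∃ s : Cn n → ℂ, AnalyticAt ℂ s x ∧ fderiv ℂ s x ≠ 0 ∧
      ∀ᶠ y in 𝓝 x, y ∈ c.preimage D ↔ s y = 0

/-- `s` is a defining function of (the preimage of) `D` on the chart `Ũ`: a holomorphic function on
`Ũ` whose zero set is the preimage of `D`, with non-vanishing differential along it. -/
structure IsDefiningFunction {X : Type u} [TopologicalSpace X] {n : ℕ} (c : OrbiChart X n)
    (D : Set X) (s : Cn n → ℂ) : Prop where
  holomorphic : AnalyticOnNhd ℂ s c.dom
  zero_iff : ∀ x ∈ c.dom, s x = 0 ↔ c.proj x ∈ D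
  fderiv_ne_zero : ∀ x ∈ c.preimage D, fderiv ℂ s x ≠ 0

/-- The uniformising charts of `X` on which `D` has a defining function (a nowhere vanishing one if
the chart does not meet `D`). For a closed suborbifold `D` of codimension one these charts form an
atlas of `X`, and their intersections with `D` form an atlas of `D`; they contain the charts of the
basic assumption, on which `z_n` is a defining function. -/
def ComplexOrbifold.DivisorChart {X : Type u} [TopologicalSpace X] {n : ℕ}
    (O : ComplexOrbifold X n) (D : Set X) : Type (max u 1) :=
  {c : OrbiChart X n // c ∈ O.atlas ∧ ∃ s, IsDefiningFunction c D s}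

/-- The basic assumption on the pair `(X, D)`: every point of `D` is covered by a uniformising chart
with holomorphic coordinates `z = (z_1, …, z_n)`, `n = m + 1`, such that `D` is `{z_n = 0}` and each
`γ ∈ Γ` acts as a matrix with blocks `A ∈ GL(n - 1, ℂ)`, `*`, `0` and an `(α - 1)`-th root of
`det A`. -/
def ComplexOrbifold.BasicAssumption {X : Type u} [TopologicalSpace X] {m : ℕ}
    (O : ComplexOrbifold X (m + 1)) (D : Set X) (α : ℕ) : Prop :=
  ∀ p ∈ D, ∃ c ∈ O.atlas, p ∈ c.range ∧ ∃ z : Cn (m + 1) → Cn (m + 1),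
    AnalyticOnNhd ℂ z c.dom ∧ Set.InjOn z c.dom ∧
    (∀ x ∈ c.dom, Function.Bijective (fderiv ℂ z x)) ∧
    (∀ x ∈ c.dom, c.proj x ∈ D ↔ z x (Fin.last m) = 0) ∧
    ∀ γ : c.Γ, ∃ M : Matrix (Fin (m + 1)) (Fin (m + 1)) ℂ,
      (∀ x ∈ c.dom, z (c.act γ x) = M.mulVec (z x)) ∧
      (∀ j : Fin m, M (Fin.last m) j.castSucc = 0) ∧
      (M.submatrix Fin.castSucc Fin.castSucc).det ≠ 0 ∧
      M (Fin.last m) (Fin.last m) ^ (α - 1) = (M.submatrix Fin.castSucc Fin.castSucc).det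

/-! ### Systems of charts and holomorphic line orbibundles

The charts `Ũ` of an orbifold `X` and the charts `D̃ ⊆ Ũ` of a suborbifold `D` are treated on the same
footing: both are complex submanifolds of `ℂⁿ`. -/

/-- The holomorphic tangent space at `x` of a complex submanifold `M` of `ℂⁿ`: the common kernel of
the differentials of the holomorphic functions that vanish on `M` near `x`. -/
def tangent {n : ℕ} (M : Set (Cn n)) (x : Cn n) : Submodule ℂ (Cn n) where
  carrier := {v | ∀ f : Cn n → ℂ, AnalyticAt ℂ f x → (∀ᶠ y in 𝓝[M] x, f y = 0) → fderiv ℂ f x v = 0}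
  add_mem' hv hw f hf h := by rw [map_add, hv f hf h, hw f hf h, add_zero]
  zero_mem' f _ _ := map_zero _
  smul_mem' a v hv f hf h := by rw [map_smul, hv f hf h, smul_zero]

/-- A system of charts of a (possibly non-effective) complex orbifold of dimension `d`: the charts are
`d`-dimensional complex submanifolds of `ℂⁿ`, and the injections are restrictions of holomorphic
immersions. -/
structure ChartSystem (n d : ℕ) where
  Chart : Type u
  carrier : Chart → Set (Cn n)
  Inj : Chart → Chart → Set (Cn n → Cn n)
  mapsTo : ∀ {i j l}, l ∈ Inj i j → Set.MapsTo l (carrier i) (carrier j)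
  holomorphic : ∀ {i j l}, l ∈ Inj i j → AnalyticOnNhd ℂ l (carrier i)
  injective_fderiv : ∀ {i j l}, l ∈ Inj i j → ∀ x ∈ carrier i, Function.Injective (fderiv ℂ l x)
  comp_mem : ∀ {i j k l l'}, l ∈ Inj i j → l' ∈ Inj j k → (fun x => l' (l x)) ∈ Inj i k
  exists_frame : ∀ i, ∀ x ∈ carrier i, ∃ τ : Fin d → Cn n → Cn n, (∀ k, AnalyticAt ℂ (τ k) x) ∧
    ∀ᶠ y in 𝓝[carrier i] x, LinearIndependent ℂ (fun k => τ k y) ∧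
      Submodule.span ℂ (Set.range fun k => τ k y) = tangent (carrier i) y

namespace ChartSystem

variable {n d : ℕ} (S : ChartSystem.{u} n d)

/-- The map of charts underlying an injection. -/
abbrev app {S : ChartSystem.{u} n d} {i j : S.Chart} (l : S.Inj i j) (x : S.carrier i) : S.carrier j :=
  ⟨l.1 x.1, S.mapsTo l.2 x.2⟩

/-- Composition of injections. -/
abbrev comp {S : ChartSystem.{u} n d} {i j k : S.Chart} (l : S.Inj i j) (l' : S.Inj j k) : S.Inj i k :=
  ⟨fun x => l'.1 (l.1 x), S.comp_mem l.2 l'.2⟩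

/-- The holomorphic tangent space of the chart `i` at the point `x`. -/
abbrev T (i : S.Chart) (x : S.carrier i) : Submodule ℂ (Cn n) := tangent (S.carrier i) x.1

/-- The complex-valued function `u` on the chart `i` is holomorphic near `x`. -/
def HolFun (i : S.Chart) (x : S.carrier i) (u : S.carrier i → ℂ) : Prop :=
  ∃ f : Cn n → ℂ, AnalyticAt ℂ f x.1 ∧ ∀ᶠ y in 𝓝 x, u y = f y.1

end ChartSystem

/-- A holomorphic line orbibundle on the orbifold with the system of charts `S`: a holomorphic line
bundle over each chart `i` (with fibres `Fiber i x`, and `IsHol i x σ` saying that the section `σ` is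
holomorphic near `x`), with bundle maps `λ^* = pull λ` for the injections `λ`, functorial in `λ`. -/
structure LineOrbibundle {n d : ℕ} (S : ChartSystem.{u} n d) where
  Fiber : ∀ i, S.carrier i → Type
  [addCommGroup : ∀ i x, AddCommGroup (Fiber i x)]
  [module : ∀ i x, Module ℂ (Fiber i x)]
  IsHol : ∀ i, S.carrier i → (∀ y, Fiber i y) → Prop
  pull : ∀ {i j} (l : S.Inj i j) (x : S.carrier i), Fiber j (ChartSystem.app l x) ≃ₗ[ℂ] Fiber i x
  /-- Near each point there is a local frame `e` such that the holomorphic sections are exactly the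
  multiples of `e` by holomorphic functions. -/
  exists_frame : ∀ i x, ∃ e : ∀ y, Fiber i y,
    (∀ᶠ y in 𝓝 x, e y ≠ 0 ∧ ∀ v : Fiber i y, ∃ a : ℂ, v = a • e y) ∧
    ∀ᶠ y in 𝓝 x, ∀ σ : ∀ y, Fiber i y,
      IsHol i y σ ↔ ∃ u, S.HolFun i y u ∧ ∀ᶠ z in 𝓝 y, σ z = u z • e z
  pull_comp : ∀ {i j k} (l : S.Inj i j) (l' : S.Inj j k) (x : S.carrier i)
    (v : Fiber k (ChartSystem.app (ChartSystem.comp l l') x)),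
    pull (ChartSystem.comp l l') x v = pull l x (pull l' (ChartSystem.app l x) v)
  isHol_pull : ∀ {i j} (l : S.Inj i j) (x : S.carrier i) (σ : ∀ y, Fiber j y),
    IsHol j (ChartSystem.app l x) σ → IsHol i x (fun y => pull l y (σ (ChartSystem.app l y)))

attribute [instance] LineOrbibundle.addCommGroup LineOrbibundle.module

/-- An isomorphism of holomorphic line orbibundles: fibrewise linear isomorphisms over each chart,
biholomorphic (they identify the holomorphic sections) and compatible with the bundle maps of all
injections, in particular with the action of the local uniformising groups. -/
structure LineOrbibundle.Iso {n d : ℕ} {S : ChartSystem.{u} n d} (L L' : LineOrbibundle S) where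
  equiv : ∀ i (x : S.carrier i), L.Fiber i x ≃ₗ[ℂ] L'.Fiber i x
  isHol_iff : ∀ i x σ, L.IsHol i x σ ↔ L'.IsHol i x (fun y => equiv i y (σ y))
  pull_comm : ∀ {i j} (l : S.Inj i j) (x : S.carrier i) (v : L.Fiber j (ChartSystem.app l x)),
    equiv i x (L.pull l x v) = L'.pull l x (equiv j (ChartSystem.app l x) v)

/-! #### Auxiliary facts on holomorphic functions and tangent spaces -/

namespace ChartSystem

variable {n d : ℕ} {S : ChartSystem.{u} n d} {i j : S.Chart}

theorem continuousAt_app (l : S.Inj i j) (x : S.carrier i) : ContinuousAt (app l) x := by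
  have h : ContinuousAt (fun y : S.carrier i => l.1 y.1) x :=
    (S.holomorphic l.2 x.1 x.2).continuousAt.comp continuousAt_subtype_val
  exact tendsto_subtype_rng.2 h

theorem HolFun.comp_app {l : S.Inj i j} {x : S.carrier i} {u : S.carrier j → ℂ}
    (h : S.HolFun j (app l x) u) : S.HolFun i x (fun y => u (app l y)) := by
  obtain ⟨f, hf, hu⟩ := h
  exact ⟨f ∘ l.1, AnalyticAt.comp (f := l.1) hf (S.holomorphic l.2 x.1 x.2),
    (continuousAt_app l x).eventually hu⟩

theorem HolFun.congr {x : S.carrier i} {u v : S.carrier i → ℂ} (h : S.HolFun i x u)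
    (huv : ∀ᶠ y in 𝓝 x, v y = u y) : S.HolFun i x v := by
  obtain ⟨f, hf, hu⟩ := h
  exact ⟨f, hf, by filter_upwards [hu, huv] with y h1 h2; rw [h2, h1]⟩

theorem HolFun.const {x : S.carrier i} (a : ℂ) : S.HolFun i x (fun _ => a) :=
  ⟨fun _ => a, analyticAt_const, Eventually.of_forall fun _ => rfl⟩

theorem HolFun.mul {x : S.carrier i} {u v : S.carrier i → ℂ} (h : S.HolFun i x u)
    (h' : S.HolFun i x v) : S.HolFun i x (fun y => u y * v y) := by
  obtain ⟨f, hf, hu⟩ := h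
  obtain ⟨g, hg, hv⟩ := h'
  exact ⟨fun y => f y * g y, hf.mul hg, by filter_upwards [hu, hv] with y h1 h2; rw [h1, h2]⟩

theorem HolFun.prod {x : S.carrier i} {k : ℕ} {u : Fin k → S.carrier i → ℂ}
    (h : ∀ a, S.HolFun i x (u a)) : S.HolFun i x (fun y => ∏ a, u a y) := by
  choose f hf hu using h
  refine ⟨fun y => ∏ a, f a y, Finset.analyticAt_fun_prod _ fun a _ => hf a, ?_⟩
  filter_upwards [eventually_all.2 hu] with y hy
  exact Finset.prod_congr rfl fun a _ => hy a

theorem HolFun.inv {x : S.carrier i} {u : S.carrier i → ℂ} (h : S.HolFun i x u) (h0 : u x ≠ 0) :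
    S.HolFun i x (fun y => (u y)⁻¹) := by
  obtain ⟨f, hf, hu⟩ := h
  refine ⟨fun y => (f y)⁻¹, hf.inv ?_, by filter_upwards [hu] with y h1; rw [h1]⟩
  rwa [← hu.self_of_nhds]

theorem HolFun.eventually {x : S.carrier i} {u : S.carrier i → ℂ} (h : S.HolFun i x u) :
    ∀ᶠ y in 𝓝 x, S.HolFun i y u := by
  obtain ⟨f, hf, hu⟩ := h
  filter_upwards [continuousAt_subtype_val.eventually hf.eventually_analyticAt,
    eventually_eventually_nhds.2 hu] with y h1 h2
  exact ⟨f, h1, h2⟩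

theorem finrank_T (x : S.carrier i) : Module.finrank ℂ (S.T i x) = d := by
  obtain ⟨τ, -, h⟩ := S.exists_frame i x.1 x.2
  obtain ⟨h1, h2⟩ := h.self_of_nhdsWithin x.2
  rw [T, ← h2, finrank_span_eq_card h1, Fintype.card_fin]

/-- The differential of an injection. -/
theorem fderiv_mem_T (l : S.Inj i j) (x : S.carrier i) (v : Cn n) (hv : v ∈ S.T i x) :
    fderiv ℂ l.1 x.1 v ∈ S.T j (app l x) := by
  intro f hf h0
  have hl := S.holomorphic l.2 x.1 x.2
  have h1 := hv (f ∘ l.1) (AnalyticAt.comp (f := l.1) hf hl) ?_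
  · rw [fderiv_comp (f := l.1) x.1 hf.differentiableAt hl.differentiableAt] at h1
    exact h1
  · exact (tendsto_nhdsWithin_of_tendsto_nhds_of_eventually_within _
      (hl.continuousAt.tendsto.mono_left nhdsWithin_le_nhds)
      (eventually_nhdsWithin_of_forall fun y hy => S.mapsTo l.2 hy)).eventually h0

/-- The differential of an injection, as an isomorphism of tangent spaces. -/
noncomputable def tangentEquiv (l : S.Inj i j) (x : S.carrier i) : S.T i x ≃ₗ[ℂ] S.T j (app l x) :=
  LinearEquiv.ofInjectiveOfFinrankEq
    ((fderiv ℂ l.1 x.1 : Cn n →ₗ[ℂ] Cn n).restrict (fderiv_mem_T l x))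
    (fun v w h => Subtype.ext (S.injective_fderiv l.2 x.1 x.2 (congrArg Subtype.val h)))
    (by rw [finrank_T, finrank_T])

theorem coe_tangentEquiv (l : S.Inj i j) (x : S.carrier i) (v : S.T i x) :
    (tangentEquiv l x v : Cn n) = fderiv ℂ l.1 x.1 v.1 := rfl

/-- The differential of an injection, as an isomorphism of the ambient vector space. -/
noncomputable def ambientEquiv (l : S.Inj i j) (x : S.carrier i) : Cn n ≃ₗ[ℂ] Cn n :=
  LinearEquiv.ofInjectiveEndo (fderiv ℂ l.1 x.1 : Cn n →ₗ[ℂ] Cn n)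
    (S.injective_fderiv l.2 x.1 x.2)

theorem ambientEquiv_apply (l : S.Inj i j) (x : S.carrier i) (v : Cn n) :
    ambientEquiv l x v = fderiv ℂ l.1 x.1 v := rfl

theorem fderiv_comp_inj {k : S.Chart} (l : S.Inj i j) (l' : S.Inj j k) (x : S.carrier i)
    (v : Cn n) : fderiv ℂ (comp l l').1 x.1 v = fderiv ℂ l'.1 (app l x).1 (fderiv ℂ l.1 x.1 v) := by
  have h := fderiv_comp x.1 (S.holomorphic l'.2 _ (app l x).2).differentiableAt
    (S.holomorphic l.2 x.1 x.2).differentiableAt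
  exact congrArg (fun A : Cn n →L[ℂ] Cn n => A v) h

end ChartSystem
namespace LineOrbibundle

variable {n d : ℕ} {S : ChartSystem.{u} n d}

/-- `e` is a local holomorphic frame of the line orbibundle near `x`. -/
def IsFrame (L : LineOrbibundle S) (i : S.Chart) (x : S.carrier i) (e : ∀ y, L.Fiber i y) : Prop :=
  (∀ᶠ y in 𝓝 x, e y ≠ 0 ∧ ∀ v : L.Fiber i y, ∃ a : ℂ, v = a • e y) ∧
    ∀ᶠ y in 𝓝 x, ∀ σ : ∀ y, L.Fiber i y,
      L.IsHol i y σ ↔ ∃ u, S.HolFun i y u ∧ ∀ᶠ z in 𝓝 y, σ z = u z • e z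

theorem IsFrame.isHol {L : LineOrbibundle S} {i : S.Chart} {x : S.carrier i}
    {e : ∀ y, L.Fiber i y} (h : L.IsFrame i x e) : L.IsHol i x e :=
  (h.2.self_of_nhds e).2 ⟨fun _ => 1, .const 1, Eventually.of_forall fun _ => (one_smul _ _).symm⟩

theorem IsFrame.eventually {L : LineOrbibundle S} {i : S.Chart} {x : S.carrier i}
    {e : ∀ y, L.Fiber i y} (h : L.IsFrame i x e) : ∀ᶠ y in 𝓝 x, L.IsFrame i y e := by
  filter_upwards [eventually_eventually_nhds.2 h.1, eventually_eventually_nhds.2 h.2] with y h1 h2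
  exact ⟨h1, h2⟩

/-- A functional that takes the value one on a given non-zero vector. -/
theorem exists_dual_eq_one {V : Type} [AddCommGroup V] [Module ℂ V] (v : V) :
    ∃ φ : Module.Dual ℂ V, v ≠ 0 → φ v = 1 := by
  by_cases hv : v = 0
  · exact ⟨0, fun h => absurd hv h⟩
  · obtain ⟨φ, hφ⟩ := Module.Projective.exists_dual_eq_one ℂ hv
    exact ⟨φ, fun _ => hφ⟩

/-- The dual `-L` of a line orbibundle `L`, with the inverse transposed bundle maps. A section is
holomorphic if its pairings with the holomorphic sections of `L` are holomorphic functions. -/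
noncomputable def dual (L : LineOrbibundle S) : LineOrbibundle S where
  Fiber i x := Module.Dual ℂ (L.Fiber i x)
  IsHol i x σ := ∀ᶠ y in 𝓝 x, ∀ τ : ∀ y, L.Fiber i y, L.IsHol i y τ →
    S.HolFun i y (fun z => σ z (τ z))
  pull l x := (L.pull l x).symm.dualMap
  exists_frame i x := by
    obtain ⟨e, he⟩ : ∃ e, L.IsFrame i x e := L.exists_frame i x
    choose e' he' using fun y => exists_dual_eq_one (e y)
    refine ⟨e', ?_, ?_⟩
    · filter_upwards [he.1] with y hy
      refine ⟨fun h => ?_, fun φ => ⟨φ (e y), LinearMap.ext fun v => ?_⟩⟩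
      · have := he' y hy.1
        rw [h] at this
        simp at this
      · obtain ⟨a, rfl⟩ := hy.2 v
        simp [he' y hy.1, mul_comm]
    · filter_upwards [he.eventually] with y hy σ
      constructor
      · intro h
        refine ⟨fun z => σ z (e z), h.self_of_nhds e hy.isHol, ?_⟩
        filter_upwards [hy.1] with z hz
        refine LinearMap.ext fun v => ?_
        obtain ⟨a, rfl⟩ := hz.2 v
        simp [he' z hz.1, mul_comm]
      · rintro ⟨u, hu, hσ⟩
        filter_upwards [hy.eventually, hu.eventually, eventually_eventually_nhds.2 hσ]
          with z hz huz hσz τ hτ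
        obtain ⟨w, hw, hτw⟩ := (hz.2.self_of_nhds τ).1 hτ
        refine (huz.mul hw).congr ?_
        filter_upwards [hσz, hτw, hz.1] with t h1 h2 h3
        rw [h1, h2]
        simp [he' t h3.1, mul_comm]
  pull_comp l l' x φ := by
    refine LinearMap.ext fun v => ?_
    obtain ⟨w, rfl⟩ := (L.pull (ChartSystem.comp l l') x).surjective v
    have h := L.pull_comp l l' x w
    simp only [LinearEquiv.dualMap_apply, LinearEquiv.symm_apply_apply]
    rw [h, LinearEquiv.symm_apply_apply, LinearEquiv.symm_apply_apply]
  isHol_pull {i j} l x σ hσ := by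
    filter_upwards [(ChartSystem.continuousAt_app l x).eventually
      (eventually_eventually_nhds.2 hσ)] with y hy τ hτ
    obtain ⟨e, he⟩ : ∃ e, L.IsFrame j (ChartSystem.app l y) e := L.exists_frame j _
    obtain ⟨f, hf⟩ : ∃ f, L.IsFrame i y f := L.exists_frame i y
    obtain ⟨u, hu, hτu⟩ := (hf.2.self_of_nhds τ).1 hτ
    obtain ⟨w, hw, hew⟩ := (hf.2.self_of_nhds _).1 (L.isHol_pull l y e he.isHol)
    have hw0 : w y ≠ 0 := by
      intro h0
      have h1 := hew.self_of_nhds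
      rw [h0, zero_smul, LinearEquiv.map_eq_zero_iff] at h1
      exact he.1.self_of_nhds.1 h1
    have h2 := (hy.self_of_nhds e he.isHol).comp_app
    refine ((hu.mul (hw.inv hw0)).mul h2).congr ?_
    have hw0' : ∀ᶠ z in 𝓝 y, w z ≠ 0 := by
      obtain ⟨g, hg, hwg⟩ := hw
      have : g y.1 ≠ 0 := by rwa [← hwg.self_of_nhds]
      filter_upwards [hwg, continuousAt_subtype_val.eventually
        (hg.continuousAt.eventually_ne this)] with z h3 h4
      rwa [h3]
    filter_upwards [hτu, hew, hw0'] with z h3 h4 h5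
    have h6 : τ z = L.pull l z ((u z * (w z)⁻¹) • e (ChartSystem.app l z)) := by
      rw [map_smul, h4, h3, smul_smul, inv_mul_cancel_right₀ h5]
    rw [LinearEquiv.dualMap_apply, h6, LinearEquiv.symm_apply_apply, map_smul, smul_eq_mul]

/-- The `k`-fold tensor power `kL` of a line orbibundle `L`. -/
noncomputable def pow (k : ℕ) (L : LineOrbibundle S) : LineOrbibundle S where
  Fiber i x := PiTensorProduct ℂ fun _ : Fin k => L.Fiber i x
  IsHol i x σ := ∃ (u : S.carrier i → ℂ) (τ : Fin k → ∀ y, L.Fiber i y),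
    S.HolFun i x u ∧ (∀ a, L.IsHol i x (τ a)) ∧
      ∀ᶠ y in 𝓝 x, σ y = u y • PiTensorProduct.tprod ℂ fun a => τ a y
  pull l x := PiTensorProduct.congr fun _ => L.pull l x
  exists_frame i x := by
    obtain ⟨e, he⟩ : ∃ e, L.IsFrame i x e := L.exists_frame i x
    have key : ∀ y, (∀ v : L.Fiber i y, ∃ a : ℂ, v = a • e y) → ∀ t : Fin k → L.Fiber i y,
        ∀ c : Fin k → ℂ, (∀ a, t a = c a • e y) → PiTensorProduct.tprod ℂ t
          = (∏ a, c a) • PiTensorProduct.tprod ℂ fun _ : Fin k => e y := by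
      intro y _ t c hc
      rw [← MultilinearMap.map_smul_univ]
      exact congrArg _ (funext hc)
    refine ⟨fun y => PiTensorProduct.tprod ℂ fun _ => e y, ?_, ?_⟩
    · filter_upwards [he.1] with y hy
      constructor
      · intro h0
        obtain ⟨φ, hφ⟩ := exists_dual_eq_one (e y)
        have h1 := congrArg (PiTensorProduct.lift ((MultilinearMap.mkPiAlgebra ℂ (Fin k) ℂ).compLinearMap
          fun _ => φ)) h0
        simp [hφ hy.1] at h1
      · intro v
        induction v using PiTensorProduct.induction_on with
        | smul_tprod r t =>
          choose c hc using fun a => hy.2 (t a)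
          exact ⟨r * ∏ a, c a, by rw [key y hy.2 t c hc, smul_smul]⟩
        | add v w hv hw =>
          obtain ⟨a, rfl⟩ := hv
          obtain ⟨b, rfl⟩ := hw
          exact ⟨a + b, (add_smul _ _ _).symm⟩
    · filter_upwards [he.eventually] with y hy σ
      constructor
      · rintro ⟨u, τ, hu, hτ, hσ⟩
        choose w hw hτw using fun a => (hy.2.self_of_nhds (τ a)).1 (hτ a)
        refine ⟨fun z => u z * ∏ a, w a z, hu.mul (.prod hw), ?_⟩
        filter_upwards [hσ, eventually_all.2 hτw, hy.1] with z h1 h2 h3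
        rw [h1, key z h3.2 _ _ h2, smul_smul]
      · rintro ⟨u, hu, hσ⟩
        exact ⟨u, fun _ => e, hu, fun _ => hy.isHol, hσ⟩
  pull_comp l l' x v := by
    induction v using PiTensorProduct.induction_on with
    | smul_tprod r t =>
      simp only [map_smul, PiTensorProduct.congr_tprod]
      refine congrArg (fun s => r • PiTensorProduct.tprod ℂ s)
        (funext fun a : Fin k => (?_ : _ = (_ : L.Fiber _ x)))
      exact L.pull_comp l l' x (t a)
    | add v w hv hw => simp only [map_add, hv, hw]
  isHol_pull l x σ := by
    rintro ⟨u, τ, hu, hτ, hσ⟩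
    refine ⟨_, fun a y => L.pull l y (τ a (ChartSystem.app l y)), hu.comp_app,
      fun a => L.isHol_pull l x (τ a) (hτ a), ?_⟩
    filter_upwards [(ChartSystem.continuousAt_app l x).eventually hσ] with y hy
    rw [hy, map_smul, PiTensorProduct.congr_tprod]

/-- The line orbibundle with trivial bundles over the charts and bundle maps given by multiplication
with nowhere vanishing holomorphic functions `ξ λ` that satisfy the cocycle condition. -/
noncomputable def ofCocycle (ξ : ∀ {i j}, S.Inj i j → S.carrier i → ℂ)
    (h_hol : ∀ {i j} (l : S.Inj i j) (x : S.carrier i), S.HolFun i x (ξ l))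
    (h_ne : ∀ {i j} (l : S.Inj i j) (x : S.carrier i), ξ l x ≠ 0)
    (h_comp : ∀ {i j k} (l : S.Inj i j) (l' : S.Inj j k) (x : S.carrier i),
      ξ (ChartSystem.comp l l') x = ξ l x * ξ l' (ChartSystem.app l x)) : LineOrbibundle S where
  Fiber _ _ := ℂ
  IsHol i x σ := S.HolFun i x σ
  pull l x := LinearEquiv.smulOfNeZero ℂ ℂ (ξ l x) (h_ne l x)
  exists_frame i x := by
    refine ⟨fun _ => 1, Eventually.of_forall fun y => ⟨one_ne_zero, fun v => ⟨v, by simp⟩⟩,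
      Eventually.of_forall fun y σ => ⟨fun h => ⟨σ, h, by simp⟩, ?_⟩⟩
    rintro ⟨u, hu, hσ⟩
    exact hu.congr (by simpa using hσ)
  pull_comp l l' x v := by
    simp [LinearEquiv.smulOfNeZero_apply, h_comp, mul_assoc]
  isHol_pull l x σ hσ := (h_hol l x).mul hσ.comp_app

end LineOrbibundle
/-! ### The canonical and the conormal orbibundle -/

theorem analyticAt_form {n k : ℕ} {x : Cn n} (η : Cn n → Cn n [⋀^Fin k]→ₗ[ℂ] ℂ)
    (hη : ∀ v, AnalyticAt ℂ (fun y => η y v) x) (a : Fin k → Cn n → Cn n)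
    (ha : ∀ j, AnalyticAt ℂ (a j) x) : AnalyticAt ℂ (fun y => η y fun j => a j y) x := by
  have h : (fun y => η y fun j => a j y) = fun y => ∑ r : Fin k → Fin n,
      (∏ j, a j y (r j)) * η y fun j => Pi.basisFun ℂ (Fin n) (r j) := by
    funext y
    have h1 : (fun j => a j y) = fun j => ∑ p, a j y p • Pi.basisFun ℂ (Fin n) p := by
      funext j
      exact ((Pi.basisFun ℂ (Fin n)).sum_repr (a j y)).symm
    rw [h1, ← AlternatingMap.coe_multilinearMap, MultilinearMap.map_sum]
    exact Finset.sum_congr rfl fun r _ => by rw [MultilinearMap.map_smul_univ, smul_eq_mul]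
  rw [h]
  refine Finset.analyticAt_fun_sum _ fun r _ => ?_
  refine (Finset.analyticAt_fun_prod _ fun j _ => ?_).mul (hη _)
  exact ((ContinuousLinearMap.proj (R := ℂ) (φ := fun _ : Fin n => ℂ) (r j)).analyticAt _).comp (ha j)

theorem analyticAt_functional {n : ℕ} {x : Cn n} (ξ : Cn n → Module.Dual ℂ (Cn n))
    (hξ : ∀ v, AnalyticAt ℂ (fun y => ξ y v) x) (a : Cn n → Cn n)
    (ha : AnalyticAt ℂ a x) : AnalyticAt ℂ (fun y => ξ y (a y)) x := by
  have h : (fun y => ξ y (a y)) = fun y => ∑ p, a y p * ξ y (Pi.basisFun ℂ (Fin n) p) := by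
    funext y
    conv_lhs => rw [← (Pi.basisFun ℂ (Fin n)).sum_repr (a y)]
    rw [map_sum]
    exact Finset.sum_congr rfl fun r _ => by rw [map_smul, smul_eq_mul]; rfl
  rw [h]
  refine Finset.analyticAt_fun_sum _ fun p _ => AnalyticAt.mul ?_ (hξ _)
  exact ((ContinuousLinearMap.proj (R := ℂ) (φ := fun _ : Fin n => ℂ) p).analyticAt _).comp ha

theorem analyticAt_fderiv_apply {n : ℕ} {F : Type} [NormedAddCommGroup F] [NormedSpace ℂ F]
    [CompleteSpace F] {x : Cn n} {f : Cn n → F} (hf : AnalyticAt ℂ f x) (v : Cn n) :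
    AnalyticAt ℂ (fun y => fderiv ℂ f y v) x :=
  ((ContinuousLinearMap.apply ℂ F v).analyticAt _).comp hf.fderiv

/-- Top-degree forms on a space with a given basis are proportional. -/
theorem form_smul_comm {d : ℕ} {V : Type} [AddCommGroup V] [Module ℂ V]
    (b : Module.Basis (Fin d) ℂ V) (f g : V [⋀^Fin d]→ₗ[ℂ] ℂ) : g b • f = f b • g := by
  rw [f.eq_smul_basis_det b, g.eq_smul_basis_det b]
  simp only [AlternatingMap.smul_apply, smul_smul, smul_eq_mul]
  ring_nf

/-- A basis of a submodule made of vectors of the ambient space. -/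
theorem exists_basis_of_span_eq {n d : ℕ} {W : Submodule ℂ (Cn n)} {t : Fin d → Cn n}
    (h : LinearIndependent ℂ t) (h' : Submodule.span ℂ (Set.range t) = W) :
    ∃ b : Module.Basis (Fin d) ℂ W, ∀ k, (b k : Cn n) = t k := by
  subst h'
  exact ⟨Module.Basis.span h, fun k => congrArg Subtype.val (Module.Basis.span_apply h k)⟩

/-- The functional `v ↦ det (v, t_1, …, t_m)` on `ℂᵐ⁺¹`. -/
noncomputable def detFunctional {m : ℕ} (t : Fin m → Cn (m + 1)) : Module.Dual ℂ (Cn (m + 1)) where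
  toFun v := (Pi.basisFun ℂ (Fin (m + 1))).det.curryLeft v t
  map_add' v w := by simp
  map_smul' a v := by simp

theorem detFunctional_apply {m : ℕ} (t : Fin m → Cn (m + 1)) (v : Cn (m + 1)) :
    detFunctional t v = (Pi.basisFun ℂ (Fin (m + 1))).det (Fin.cons v t) := rfl

theorem detFunctional_spec {m : ℕ} {W : Submodule ℂ (Cn (m + 1))} {t : Fin m → Cn (m + 1)}
    (h : LinearIndependent ℂ t) (h' : Submodule.span ℂ (Set.range t) = W) :
    detFunctional t ∈ W.dualAnnihilator ∧ detFunctional t ≠ 0 ∧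
      LinearMap.ker (detFunctional t) = W := by
  have hW : Module.finrank ℂ W = m := by rw [← h', finrank_span_eq_card h, Fintype.card_fin]
  have h1 : detFunctional t ∈ W.dualAnnihilator := by
    rw [Submodule.mem_dualAnnihilator]
    intro w hw
    have hle : W ≤ LinearMap.ker (detFunctional t) := by
      rw [← h', Submodule.span_le]
      rintro _ ⟨k, rfl⟩
      rw [SetLike.mem_coe, LinearMap.mem_ker, detFunctional_apply]
      exact AlternatingMap.map_eq_zero_of_eq _ _ (i := 0) (j := k.succ) (by simp)
        (Fin.succ_ne_zero k).symm
    exact hle hw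
  have h2 : detFunctional t ≠ 0 := by
    intro h0
    have hlt : W ≠ ⊤ := by
      rintro rfl
      rw [finrank_top, Module.finrank_fin_fun] at hW
      omega
    obtain ⟨v, -, hv⟩ := SetLike.exists_of_lt (lt_top_iff_ne_top.2 hlt)
    have hli : LinearIndependent ℂ (Fin.cons v t : Fin (m + 1) → Cn (m + 1)) :=
      linearIndependent_finCons.2 ⟨h, by rwa [h']⟩
    let b := basisOfLinearIndependentOfCardEqFinrank hli (by simp)
    have hb := (Pi.basisFun ℂ (Fin (m + 1))).isUnit_det b
    rw [show (b : Fin (m + 1) → Cn (m + 1)) = Fin.cons v t from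
      coe_basisOfLinearIndependentOfCardEqFinrank _ _, ← detFunctional_apply, h0] at hb
    simp at hb
  refine ⟨h1, h2, (Submodule.eq_of_le_of_finrank_eq ?_ ?_).symm⟩
  · exact fun w hw => (Submodule.mem_dualAnnihilator _).1 h1 w hw
  · have := Module.Dual.finrank_ker_add_one_of_ne_zero h2
    rw [Module.finrank_fin_fun] at this
    omega

namespace ChartSystem

variable {n d : ℕ}

/-- The canonical orbibundle `K`: its fibre at `x` consists of the alternating `d`-forms on the
tangent space (`d` being the dimension), the bundle maps are pull-backs of forms, and a section is
holomorphic if locally it is the restriction of a form with holomorphic coefficients on `ℂⁿ`. -/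
noncomputable def canonical (S : ChartSystem.{u} n d) : LineOrbibundle S where
  Fiber i x := (S.T i x) [⋀^Fin d]→ₗ[ℂ] ℂ
  IsHol i x σ := ∃ η : Cn n → Cn n [⋀^Fin d]→ₗ[ℂ] ℂ, (∀ v, AnalyticAt ℂ (fun y => η y v) x.1) ∧
    ∀ᶠ y in 𝓝 x, ∀ t : Fin d → S.T i y, σ y t = η y.1 fun k => (t k).1
  pull l x := AlternatingMap.domLCongr ℂ ℂ (Fin d) ℂ (tangentEquiv l x).symm
  exists_frame i x := by
    obtain ⟨τ, hτ, hfr⟩ := S.exists_frame i x.1 x.2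
    obtain ⟨hx1, hx2⟩ := hfr.self_of_nhdsWithin x.2
    obtain ⟨P, hP⟩ := LinearMap.exists_leftInverse_of_injective
      (Fintype.linearCombination ℂ fun k => τ k x.1)
      (LinearMap.ker_eq_bot.2 hx1.fintypeLinearCombination_injective)
    let η₀ : Cn n [⋀^Fin d]→ₗ[ℂ] ℂ := (Pi.basisFun ℂ (Fin d)).det.compLinearMap P
    have hη₀ : η₀ (fun k => τ k x.1) = 1 := by
      have : (fun k => P (τ k x.1)) = Pi.basisFun ℂ (Fin d) := by
        funext k
        have h1 := LinearMap.congr_fun hP (Pi.single k 1)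
        simpa [Fintype.linearCombination_apply_single] using h1
      change (Pi.basisFun ℂ (Fin d)).det (fun k => P (τ k x.1)) = 1
      rw [this, Module.Basis.det_self]
    have hw : ∀ y : Cn n, (∀ k, AnalyticAt ℂ (τ k) y) →
        AnalyticAt ℂ (fun z => η₀ fun k => τ k z) y := fun y hy =>
      analyticAt_form (fun _ => η₀) (fun _ => analyticAt_const) τ hy
    have hgood : ∀ᶠ y in 𝓝 x, (LinearIndependent ℂ (fun k => τ k y.1) ∧
        Submodule.span ℂ (Set.range fun k => τ k y.1) = S.T i y) ∧
        η₀ (fun k => τ k y.1) ≠ 0 := by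
      refine Eventually.and ?_ ?_
      · rw [← map_nhds_subtype_val] at hfr
        exact hfr
      · refine continuousAt_subtype_val.eventually
          ((hw x.1 hτ).continuousAt.eventually_ne ?_)
        rw [hη₀]
        exact one_ne_zero
    have hkey : ∀ y : S.carrier i, ((LinearIndependent ℂ (fun k => τ k y.1) ∧
        Submodule.span ℂ (Set.range fun k => τ k y.1) = S.T i y) ∧
        η₀ (fun k => τ k y.1) ≠ 0) → ∃ t : Fin d → S.T i y, (∀ k, (t k).1 = τ k y.1) ∧
        ∀ f : (S.T i y) [⋀^Fin d]→ₗ[ℂ] ℂ,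
          f = (f t / η₀ fun k => τ k y.1) • η₀.compLinearMap (S.T i y).subtype := by
      rintro y ⟨⟨h1, h2⟩, h3⟩
      obtain ⟨b, hb⟩ := exists_basis_of_span_eq h1 h2
      refine ⟨b, hb, fun f => ?_⟩
      have h4 := form_smul_comm b f (η₀.compLinearMap (S.T i y).subtype)
      have h5 : (η₀.compLinearMap (S.T i y).subtype) b = η₀ fun k => τ k y.1 :=
        congrArg η₀ (funext hb)
      rw [h5] at h4
      rw [div_eq_inv_mul, mul_smul, ← h4, smul_smul, inv_mul_cancel₀ h3, one_smul]
    refine ⟨fun y => η₀.compLinearMap (S.T i y).subtype, ?_, ?_⟩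
    · filter_upwards [hgood] with y hy
      obtain ⟨t, ht, hf⟩ := hkey y hy
      refine ⟨fun h0 => hy.2 ?_, fun f => ⟨_, hf f⟩⟩
      have : (η₀.compLinearMap (S.T i y).subtype) t = 0 := by rw [h0]; rfl
      rw [← this]
      exact congrArg η₀ (funext fun k => (ht k).symm)
    · filter_upwards [eventually_eventually_nhds.2 hgood, eventually_all.2 fun k =>
        continuousAt_subtype_val.eventually (hτ k).eventually_analyticAt] with y hy hτy σ
      constructor
      · rintro ⟨η, hη, hσ⟩
        refine ⟨fun z => (η z.1 fun k => τ k z.1) / η₀ fun k => τ k z.1,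
          ⟨fun z => (η z fun k => τ k z) / η₀ fun k => τ k z,
            (analyticAt_form η hη τ hτy).div (hw y.1 hτy) hy.self_of_nhds.2,
            Eventually.of_forall fun _ => rfl⟩, ?_⟩
        filter_upwards [hσ, hy] with z h1 h2
        obtain ⟨t, ht, hf⟩ := hkey z h2
        rw [← funext ht, ← h1 t, funext ht]
        exact hf (σ z)
      · rintro ⟨u, ⟨f, hf, huf⟩, hσ⟩
        refine ⟨fun z => f z • η₀, fun v => hf.mul analyticAt_const, ?_⟩
        filter_upwards [huf, hσ] with z h1 h2 t
        rw [h2, h1]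
        rfl
  pull_comp l l' x f := by
    refine AlternatingMap.ext fun t => congrArg f (funext fun k => Subtype.ext ?_)
    exact fderiv_comp_inj l l' x (t k)
  isHol_pull {i j} l x σ := by
    rintro ⟨η, hη, hσ⟩
    have hl := S.holomorphic l.2 x.1 x.2
    refine ⟨fun y => (η (l.1 y)).compLinearMap (fderiv ℂ l.1 y : Cn n →ₗ[ℂ] Cn n), fun v => ?_, ?_⟩
    · refine analyticAt_form (fun y => η (l.1 y)) (fun w => ?_) (fun k y => fderiv ℂ l.1 y (v k))
        fun k => analyticAt_fderiv_apply hl (v k)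
      exact AnalyticAt.comp (f := l.1) (g := fun y => η y w) (hη w) hl
    · filter_upwards [(continuousAt_app l x).eventually hσ] with y hy t
      exact hy fun k => tangentEquiv l y (t k)

/-- The value of an element of a fibre of the canonical orbibundle (an alternating form) on tangent
vectors. -/
def evalForm {S : ChartSystem.{u} n d} {i : S.Chart} {x : S.carrier i} (f : S.canonical.Fiber i x)
    (t : Fin d → S.T i x) : ℂ :=
  (show (S.T i x) [⋀^Fin d]→ₗ[ℂ] ℂ from f) t

/-- The conormal orbibundle `N^*` of a hypersurface: its fibre at `x` consists of the functionals on
the ambient tangent space `ℂᵐ⁺¹` that vanish on the tangent space of the hypersurface, the bundle maps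
are pull-backs, and a section is holomorphic if locally it is the restriction of a `1`-form with
holomorphic coefficients on `ℂᵐ⁺¹`. -/
noncomputable def conormal {m : ℕ} (S : ChartSystem.{u} (m + 1) m) : LineOrbibundle S where
  Fiber i x := (S.T i x).dualAnnihilator
  IsHol i x σ := ∃ ξ : Cn (m + 1) → Module.Dual ℂ (Cn (m + 1)),
    (∀ v, AnalyticAt ℂ (fun y => ξ y v) x.1) ∧
    ∀ᶠ y in 𝓝 x, (σ y : Module.Dual ℂ (Cn (m + 1))) = ξ y.1
  pull {i j} l x :=
    { toFun := fun ξ => ⟨ξ.1 ∘ₗ (ambientEquiv l x : Cn (m + 1) →ₗ[ℂ] Cn (m + 1)), by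
        rw [Submodule.mem_dualAnnihilator]
        exact fun w hw => (Submodule.mem_dualAnnihilator _).1 ξ.2 _ (fderiv_mem_T l x w hw)⟩
      invFun := fun ξ => ⟨ξ.1 ∘ₗ ((ambientEquiv l x).symm : Cn (m + 1) →ₗ[ℂ] Cn (m + 1)), by
        rw [Submodule.mem_dualAnnihilator]
        intro w hw
        obtain ⟨v, hv⟩ := (tangentEquiv l x).surjective ⟨w, hw⟩
        have h1 : ambientEquiv l x v.1 = w := congrArg Subtype.val hv
        have h2 : (ambientEquiv l x).symm w = v.1 := by rw [← h1, LinearEquiv.symm_apply_apply]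
        rw [LinearMap.comp_apply, LinearEquiv.coe_coe, h2]
        exact (Submodule.mem_dualAnnihilator _).1 ξ.2 _ v.2⟩
      left_inv := fun ξ => Subtype.ext <| LinearMap.ext fun v =>
        congrArg ξ.1 ((ambientEquiv l x).apply_symm_apply v)
      right_inv := fun ξ => Subtype.ext <| LinearMap.ext fun v =>
        congrArg ξ.1 ((ambientEquiv l x).symm_apply_apply v)
      map_add' := fun _ _ => rfl
      map_smul' := fun _ _ => rfl }
  exists_frame i x := by
    obtain ⟨τ, hτ, hfr⟩ := S.exists_frame i x.1 x.2
    have hgood : ∀ᶠ y in 𝓝 x, LinearIndependent ℂ (fun k => τ k y.1) ∧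
        Submodule.span ℂ (Set.range fun k => τ k y.1) = S.T i y := by
      rw [← map_nhds_subtype_val] at hfr
      exact hfr
    have hφ : ∀ y : Cn (m + 1), (∀ k, AnalyticAt ℂ (τ k) y) → ∀ v,
        AnalyticAt ℂ (fun z => detFunctional (fun k => τ k z) v) y := fun y hy v => by
      have h := analyticAt_form (fun _ => (Pi.basisFun ℂ (Fin (m + 1))).det)
        (fun _ => analyticAt_const) (Fin.cons (fun _ => v) τ)
        (Fin.cases analyticAt_const hy)
      refine h.congr (Eventually.of_forall fun z => ?_)
      change _ = (Pi.basisFun ℂ (Fin (m + 1))).det (Fin.cons v fun k => τ k z)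
      exact congrArg _ (funext fun k => Fin.cases rfl (fun _ => rfl) k)
    have hex : ∀ y : S.carrier i, ∃ e : (S.T i y).dualAnnihilator,
        (LinearIndependent ℂ (fun k => τ k y.1) ∧
          Submodule.span ℂ (Set.range fun k => τ k y.1) = S.T i y) →
        e.1 = detFunctional fun k => τ k y.1 := by
      intro y
      by_cases h : LinearIndependent ℂ (fun k => τ k y.1) ∧
          Submodule.span ℂ (Set.range fun k => τ k y.1) = S.T i y
      · exact ⟨⟨_, (detFunctional_spec h.1 h.2).1⟩, fun _ => rfl⟩
      · exact ⟨0, fun h' => absurd h' h⟩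
    choose e he using hex
    have hkey : ∀ y : S.carrier i, (LinearIndependent ℂ (fun k => τ k y.1) ∧
        Submodule.span ℂ (Set.range fun k => τ k y.1) = S.T i y) →
        ∀ v, detFunctional (fun k => τ k y.1) v ≠ 0 → ∀ ξ : (S.T i y).dualAnnihilator,
          ξ = (ξ.1 v / detFunctional (fun k => τ k y.1) v) • e y := by
      intro y hy v hv ξ
      refine Subtype.ext (LinearMap.ext fun w => ?_)
      change ξ.1 w = _ * (e y).1 w
      rw [he y hy]
      have h1 : w - (detFunctional (fun k => τ k y.1) w / detFunctional (fun k => τ k y.1) v) • v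
          ∈ S.T i y := by
        rw [← (detFunctional_spec hy.1 hy.2).2.2, LinearMap.mem_ker, map_sub, map_smul, smul_eq_mul,
          div_mul_cancel₀ _ hv, sub_self]
      have h2 := (Submodule.mem_dualAnnihilator _).1 ξ.2 _ h1
      rw [map_sub, map_smul, smul_eq_mul, sub_eq_zero] at h2
      rw [h2]
      ring
    have hne : ∀ y : S.carrier i, (LinearIndependent ℂ (fun k => τ k y.1) ∧
        Submodule.span ℂ (Set.range fun k => τ k y.1) = S.T i y) →
        ∃ v, detFunctional (fun k => τ k y.1) v ≠ 0 := by
      intro y hy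
      by_contra! h
      exact (detFunctional_spec hy.1 hy.2).2.1 (LinearMap.ext h)
    refine ⟨e, ?_, ?_⟩
    · filter_upwards [hgood] with y hy
      refine ⟨fun h0 => (detFunctional_spec hy.1 hy.2).2.1 ?_, fun ξ => ?_⟩
      · rw [← he y hy, h0]
        rfl
      · obtain ⟨v, hv⟩ := hne y hy
        exact ⟨_, hkey y hy v hv ξ⟩
    · filter_upwards [eventually_eventually_nhds.2 hgood, eventually_all.2 fun k =>
        continuousAt_subtype_val.eventually (hτ k).eventually_analyticAt] with y hy hτy σ
      constructor
      · rintro ⟨ξ, hξ, hσ⟩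
        obtain ⟨v, hv⟩ := hne y hy.self_of_nhds
        refine ⟨fun z => ξ z.1 v / detFunctional (fun k => τ k z.1) v,
          ⟨fun z => ξ z v / detFunctional (fun k => τ k z) v,
            (hξ v).div (hφ y.1 hτy v) hv, Eventually.of_forall fun _ => rfl⟩, ?_⟩
        filter_upwards [hσ, hy, continuousAt_subtype_val.eventually
          ((hφ y.1 hτy v).continuousAt.eventually_ne hv)] with z h1 h2 h3
        rw [← h1]
        exact hkey z h2 v h3 (σ z)
      · rintro ⟨u, ⟨f, hf, huf⟩, hσ⟩
        refine ⟨fun z => f z • detFunctional fun k => τ k z, fun v => hf.mul (hφ y.1 hτy v), ?_⟩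
        filter_upwards [huf, hσ, hy] with z h1 h2 h3
        rw [h2, h1, ← he z h3]
        rfl
  pull_comp l l' x ξ := by
    refine Subtype.ext (LinearMap.ext fun v => congrArg ξ.1 ?_)
    exact fderiv_comp_inj l l' x v
  isHol_pull {i j} l x σ := by
    rintro ⟨ξ, hξ, hσ⟩
    have hl := S.holomorphic l.2 x.1 x.2
    refine ⟨fun y => ξ (l.1 y) ∘ₗ (fderiv ℂ l.1 y : Cn (m + 1) →ₗ[ℂ] Cn (m + 1)), fun v => ?_, ?_⟩
    · refine analyticAt_functional (fun y => ξ (l.1 y)) (fun w => ?_) (fun y => fderiv ℂ l.1 y v)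
        (analyticAt_fderiv_apply hl v)
      exact AnalyticAt.comp (f := l.1) (g := fun y => ξ y w) (hξ w) hl
    · filter_upwards [(continuousAt_app l x).eventually hσ] with y hy
      exact congrArg (fun ζ => ζ ∘ₗ (fderiv ℂ l.1 y.1 : Cn (m + 1) →ₗ[ℂ] Cn (m + 1))) hy

end ChartSystem
/-! ### The charts of `X` and of `D`, the bundle `[D]`, and volume forms with poles -/

theorem tangent_mono {n : ℕ} {M N : Set (Cn n)} (h : M ⊆ N) (x : Cn n) :
    tangent M x ≤ tangent N x :=
  fun _ hv f hf h0 => hv f hf (h0.filter_mono (nhdsWithin_mono x h))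

theorem tangent_of_isOpen {n : ℕ} {M : Set (Cn n)} (h : IsOpen M) {x : Cn n} (hx : x ∈ M) :
    tangent M x = ⊤ := by
  refine eq_top_iff.2 fun v _ f _ h0 => ?_
  rw [h.nhdsWithin_eq hx] at h0
  have h1 : f =ᶠ[𝓝 x] fun _ => 0 := h0
  rw [h1.fderiv_eq]
  simp

/-- The tangent space of a smooth hypersurface is the kernel of the differential of a defining
function. -/
theorem tangent_preimage {X : Type u} [TopologicalSpace X] {n : ℕ} {c : OrbiChart X n} {D : Set X}
    {s : Cn n → ℂ} (hs : IsDefiningFunction c D s) {x : Cn n} (hx : x ∈ c.preimage D) :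
    tangent (c.preimage D) x = LinearMap.ker (fderiv ℂ s x : Cn n →ₗ[ℂ] ℂ) := by
  have hsx := hs.holomorphic x hx.1
  refine le_antisymm (fun v hv => ?_) fun v hv f hf h0 => ?_
  · exact hv s hsx (eventually_nhdsWithin_of_forall fun y hy => (hs.zero_iff y hy.1).2 hy.2)
  · have hstrict := hsx.hasStrictFDerivAt
    have hrange : (fderiv ℂ s x : Cn n →ₗ[ℂ] ℂ).range = ⊤ := by
      refine LinearMap.range_eq_top.2 (LinearMap.surjective ?_)
      intro h1
      exact hs.fderiv_ne_zero x hx (ContinuousLinearMap.coe_injective h1)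
    let g := HasStrictFDerivAt.implicitFunction s (fderiv ℂ s x) hstrict hrange (s x)
    have hg : HasStrictFDerivAt g (fderiv ℂ s x : Cn n →ₗ[ℂ] ℂ).ker.subtypeL 0 :=
      hstrict.to_implicitFunction hrange
    have hsx0 : s x = 0 := (hs.zero_iff x hx.1).2 hx.2
    have hg0 : g 0 = x := hstrict.implicitFunction_apply_image hrange
    have hgs : ∀ᶠ w in 𝓝 (0 : (fderiv ℂ s x : Cn n →ₗ[ℂ] ℂ).ker), s (g w) = s x := by
      have h1 := hstrict.map_implicitFunction_eq hrange
      have h2 : Tendsto (fun w : (fderiv ℂ s x : Cn n →ₗ[ℂ] ℂ).ker => (s x, w)) (𝓝 0)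
          (𝓝 (s x, 0)) := (Continuous.prodMk_right (s x)).tendsto' _ _ rfl
      exact h2.eventually h1
    have hgc : Tendsto g (𝓝 0) (𝓝 x) := by
      have := hg.continuousAt.tendsto
      rwa [hg0] at this
    have hfg : (f ∘ g) =ᶠ[𝓝 0] fun _ => 0 := by
      filter_upwards [hgs, hgc.eventually (c.isOpen_dom.mem_nhds hx.1),
        hgc.eventually (eventually_nhdsWithin_iff.1 h0)] with w h1 h2 h3
      exact h3 ⟨h2, (hs.zero_iff _ h2).1 (h1.trans hsx0)⟩
    have h4 : HasFDerivAt (f ∘ g) ((fderiv ℂ f x).comp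
        (fderiv ℂ s x : Cn n →ₗ[ℂ] ℂ).ker.subtypeL) 0 := by
      refine HasFDerivAt.comp 0 ?_ hg.hasFDerivAt
      rw [hg0]
      exact hf.differentiableAt.hasFDerivAt
    have h5 := h4.fderiv
    rw [hfg.fderiv_eq] at h5
    have h6 := congrArg (fun A => A (⟨v, hv⟩ : (fderiv ℂ s x : Cn n →ₗ[ℂ] ℂ).ker)) h5
    simpa using h6.symm

/-- The zero set of a defining function has dense complement. -/
theorem IsDefiningFunction.frequently_ne_zero {X : Type u} [TopologicalSpace X] {n : ℕ}
    {c : OrbiChart X n} {D : Set X} {s : Cn n → ℂ} (hs : IsDefiningFunction c D s) {x : Cn n}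
    (hx : x ∈ c.dom) : ∃ᶠ y in 𝓝 x, s y ≠ 0 := by
  intro h
  have h1 : s =ᶠ[𝓝 x] fun _ => 0 := by
    filter_upwards [h] with y hy
    exact not_not.1 hy
  refine hs.fderiv_ne_zero x ⟨hx, (hs.zero_iff x hx).1 h1.self_of_nhds⟩ ?_
  rw [h1.fderiv_eq]
  simp

/-- The orbifold `X`, described by its atlas of charts on which `D` has a defining function. -/
def ComplexOrbifold.ambientSystem {X : Type u} [TopologicalSpace X] {n : ℕ}
    (O : ComplexOrbifold X n) (D : Set X) : ChartSystem.{max u 1} n n where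
  Chart := O.DivisorChart D
  carrier c := c.1.dom
  Inj c c' := {l | IsInjection c.1 c'.1 l}
  mapsTo h := IsInjection.mapsTo h
  holomorphic h := IsInjection.holomorphic h
  injective_fderiv h := IsInjection.injective_fderiv h
  comp_mem h h' := IsInjection.comp h h'
  exists_frame c x hx := by
    refine ⟨fun k _ => Pi.basisFun ℂ (Fin n) k, fun k => analyticAt_const,
      eventually_nhdsWithin_of_forall fun y hy => ⟨(Pi.basisFun ℂ (Fin n)).linearIndependent, ?_⟩⟩
    rw [tangent_of_isOpen c.1.isOpen_dom hy]
    exact (Pi.basisFun ℂ (Fin n)).span_eq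

/-- The orbifold `D`, described by its atlas induced from `X`: the charts are the preimages
`D̃ ⊆ Ũ` of `D`, with the same local uniformising groups and injections. -/
def ComplexOrbifold.suborbifoldSystem {X : Type u} [TopologicalSpace X] {m : ℕ}
    (O : ComplexOrbifold X (m + 1)) (D : Set X) : ChartSystem.{max u 1} (m + 1) m where
  Chart := O.DivisorChart D
  carrier c := c.1.preimage D
  Inj c c' := {l | IsInjection c.1 c'.1 l}
  mapsTo h x hx := by
    refine ⟨IsInjection.mapsTo h hx.1, ?_⟩
    rw [IsInjection.proj_comp h x hx.1]
    exact hx.2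
  holomorphic h x hx := IsInjection.holomorphic h x hx.1
  injective_fderiv h x hx := IsInjection.injective_fderiv h x hx.1
  comp_mem h h' := IsInjection.comp h h'
  exists_frame c x hx := by
    obtain ⟨s, hs⟩ := c.2.2
    have hsx := hs.holomorphic x hx.1
    obtain ⟨v, hv⟩ : ∃ v, fderiv ℂ s x v ≠ 0 := by
      by_contra! h
      exact hs.fderiv_ne_zero x hx (ContinuousLinearMap.ext h)
    have hrank : ∀ y ∈ c.1.preimage D,
        Module.finrank ℂ (LinearMap.ker (fderiv ℂ s y : Cn (m + 1) →ₗ[ℂ] ℂ)) = m := by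
      intro y hy
      have := Module.Dual.finrank_ker_add_one_of_ne_zero (K := ℂ)
        (f := (fderiv ℂ s y : Cn (m + 1) →ₗ[ℂ] ℂ))
        fun h => hs.fderiv_ne_zero y hy (ContinuousLinearMap.coe_injective h)
      rw [Module.finrank_fin_fun] at this
      omega
    let b := Module.finBasisOfFinrankEq ℂ _ (hrank x hx)
    refine ⟨fun k y => (b k).1 - (fderiv ℂ s y (b k).1 / fderiv ℂ s y v) • v, fun k => ?_, ?_⟩
    · exact analyticAt_const.sub (((analyticAt_fderiv_apply hsx _).div
        (analyticAt_fderiv_apply hsx v) hv).smul analyticAt_const)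
    · filter_upwards [self_mem_nhdsWithin, nhdsWithin_le_nhds
        ((analyticAt_fderiv_apply hsx v).continuousAt.eventually_ne hv)] with y hy hyv
      have hli : LinearIndependent ℂ fun k =>
          (b k).1 - (fderiv ℂ s y (b k).1 / fderiv ℂ s y v) • v := by
        rw [Fintype.linearIndependent_iff]
        intro a ha
        have h1 : ∑ k, a k • (b k).1
            = (∑ k, a k * (fderiv ℂ s y (b k).1 / fderiv ℂ s y v)) • v := by
          rw [Finset.sum_smul, ← sub_eq_zero, ← Finset.sum_sub_distrib, ← ha]
          exact Finset.sum_congr rfl fun k _ => by rw [smul_sub, smul_smul]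
        have h2 : fderiv ℂ s x (∑ k, a k • (b k).1) = 0 := by
          rw [map_sum]
          refine Finset.sum_eq_zero fun k _ => ?_
          have : fderiv ℂ s x (b k).1 = 0 := (b k).2
          rw [map_smul, this, smul_zero]
        have h3 : ∑ k, a k * (fderiv ℂ s y (b k).1 / fderiv ℂ s y v) = 0 := by
          rw [h1, map_smul, smul_eq_mul] at h2
          exact (mul_eq_zero.1 h2).resolve_right hv
        rw [h3, zero_smul] at h1
        refine Fintype.linearIndependent_iff.1 b.linearIndependent a (Subtype.ext ?_)
        simpa using h1
      refine ⟨hli, ?_⟩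
      rw [tangent_preimage hs hy]
      refine Submodule.eq_of_le_of_finrank_eq ?_ ?_
      · rw [Submodule.span_le]
        rintro _ ⟨k, rfl⟩
        change fderiv ℂ s y _ = 0
        rw [map_sub, map_smul, smul_eq_mul, div_mul_cancel₀ _ hyv, sub_self]
      · rw [finrank_span_eq_card hli, hrank y hy, Fintype.card_fin]

/-- Defining functions `f` of `D` on the charts together with the nowhere vanishing holomorphic
functions `ξ λ = f_i / (f_j ∘ λ)` for the injections `λ` from the chart `i` to the chart `j`. -/
structure ComplexOrbifold.DivisorData {X : Type u} [TopologicalSpace X] {n : ℕ}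
    (O : ComplexOrbifold X n) (D : Set X) where
  f : O.DivisorChart D → Cn n → ℂ
  isDefining : ∀ c, IsDefiningFunction c.1 D (f c)
  ξ : ∀ {c c' : O.DivisorChart D}, (O.ambientSystem D).Inj c c' →
    (O.ambientSystem D).carrier c → ℂ
  ξ_hol : ∀ {c c' : O.DivisorChart D} (l : (O.ambientSystem D).Inj c c')
    (x : (O.ambientSystem D).carrier c), (O.ambientSystem D).HolFun c x (ξ l)
  ξ_ne_zero : ∀ {c c' : O.DivisorChart D} (l : (O.ambientSystem D).Inj c c')
    (x : (O.ambientSystem D).carrier c), ξ l x ≠ 0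
  f_eq : ∀ {c c' : O.DivisorChart D} (l : (O.ambientSystem D).Inj c c')
    (x : (O.ambientSystem D).carrier c), f c x.1 = ξ l x * f c' (l.1 x.1)

/-- The line orbibundle `[D]` of the Baily divisor `D`, given by the cocycle `ξ`; the functions `f`
are its defining section. -/
noncomputable def ComplexOrbifold.DivisorData.lineOrbibundle {X : Type u} [TopologicalSpace X]
    {n : ℕ} {O : ComplexOrbifold X n} {D : Set X} (Z : O.DivisorData D) :
    LineOrbibundle (O.ambientSystem D) :=
  LineOrbibundle.ofCocycle Z.ξ Z.ξ_hol Z.ξ_ne_zero <| by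
    intro c c' c'' l l' x
    have hfreq := (Z.isDefining c).frequently_ne_zero (x := x.1) x.2
    have hmap : map Subtype.val (𝓝 x) = 𝓝 x.1 := by
      rw [map_nhds_subtype_val]
      exact c.1.isOpen_dom.nhdsWithin_eq x.2
    have hfreq' : ∃ᶠ y in 𝓝 x, Z.f c y.1 ≠ 0 := by
      rw [← hmap] at hfreq
      exact hfreq
    obtain ⟨g, hg, h1⟩ := Z.ξ_hol (ChartSystem.comp l l') x
    obtain ⟨h, hh, h2⟩ := (Z.ξ_hol l x).mul
      (ChartSystem.HolFun.comp_app (Z.ξ_hol l' (ChartSystem.app l x)))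
    have hgh : g x.1 = h x.1 := by
      by_contra hne
      have h3 : ∀ᶠ y in 𝓝 x.1, g y - h y ≠ 0 :=
        (hg.sub hh).continuousAt.eventually_ne (sub_ne_zero.2 hne)
      obtain ⟨y, hy0, hy1, hy2, hy3⟩ := (hfreq'.and_eventually
        (h1.and (h2.and (continuousAt_subtype_val.eventually h3)))).exists
      have e1 := Z.f_eq (ChartSystem.comp l l') y
      have e2 := Z.f_eq l y
      have e3 := Z.f_eq l' (ChartSystem.app l y)
      have hk : Z.f c'' (l'.1 (l.1 y.1)) ≠ 0 := fun h0 => hy0 (by rw [e1, h0, mul_zero])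
      refine hy3 (sub_eq_zero.2 ?_)
      rw [← hy1, ← hy2]
      refine mul_right_cancel₀ hk ?_
      rw [← e1, e2, e3, mul_assoc]
    exact h1.self_of_nhds.trans (hgh.trans h2.self_of_nhds.symm)

/-- The canonical orbibundle `K_X` of `X`. -/
noncomputable abbrev ComplexOrbifold.canonicalX {X : Type u} [TopologicalSpace X] {n : ℕ}
    (O : ComplexOrbifold X n) (D : Set X) : LineOrbibundle (O.ambientSystem D) :=
  (O.ambientSystem D).canonical

/-- The canonical orbibundle `K_D` of `D`. -/
noncomputable abbrev ComplexOrbifold.canonicalD {X : Type u} [TopologicalSpace X] {m : ℕ}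
    (O : ComplexOrbifold X (m + 1)) (D : Set X) : LineOrbibundle (O.suborbifoldSystem D) :=
  (O.suborbifoldSystem D).canonical

/-- The conormal orbibundle `N_D^*` of `D` in `X`. -/
noncomputable abbrev ComplexOrbifold.conormalD {X : Type u} [TopologicalSpace X] {m : ℕ}
    (O : ComplexOrbifold X (m + 1)) (D : Set X) : LineOrbibundle (O.suborbifoldSystem D) :=
  (O.suborbifoldSystem D).conormal

/-- `-K_X = α[D]` as line orbibundles on `X`. -/
def ComplexOrbifold.AnticanonicalEq {X : Type u} [TopologicalSpace X] {n : ℕ}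
    (O : ComplexOrbifold X n) (D : Set X) (α : ℕ) : Prop :=
  ∃ Z : O.DivisorData D, Nonempty ((O.canonicalX D).dual.Iso (Z.lineOrbibundle.pow α))

/-- A family of `(m + 1)`-forms `Ω` on the charts `Ũ` of `X`, `dim X = m + 1`. -/
abbrev ComplexOrbifold.FormFamily {X : Type u} [TopologicalSpace X] {m : ℕ}
    (O : ComplexOrbifold X (m + 1)) (D : Set X) : Type (max u 1) :=
  ∀ (c : O.DivisorChart D) (x : (O.ambientSystem D).carrier c),
    ((O.ambientSystem D).T c x) [⋀^Fin (m + 1)]→ₗ[ℂ] ℂ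

/-- `Ω` is a trivialising (that is, holomorphic and nowhere vanishing) section of `K_{X∖D}` that, as a
section of `K_X`, blows up to order `α` along `D`: on each chart `s^α Ω` extends to a nowhere
vanishing holomorphic form, `s` being a defining function of `D`. The values of `Ω` along `D` are
irrelevant. -/
structure ComplexOrbifold.IsVolumeFormWithPole {X : Type u} [TopologicalSpace X] {m : ℕ}
    (O : ComplexOrbifold X (m + 1)) (D : Set X) (α : ℕ) (Ω : O.FormFamily D) : Prop where
  holomorphic : ∀ c (x : (O.ambientSystem D).carrier c), c.1.proj x.1 ∉ D →
    (O.canonicalX D).IsHol c x (Ω c)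
  ne_zero : ∀ c (x : (O.ambientSystem D).carrier c), c.1.proj x.1 ∉ D → Ω c x ≠ 0
  pull_eq : ∀ c c' (l : (O.ambientSystem D).Inj c c') (x : (O.ambientSystem D).carrier c),
    c.1.proj x.1 ∉ D → (O.canonicalX D).pull l x (Ω c' (ChartSystem.app l x)) = Ω c x
  pole : ∀ c, ∃ s, IsDefiningFunction c.1 D s ∧
    ∃ η : ∀ x : (O.ambientSystem D).carrier c,
        ((O.ambientSystem D).T c x) [⋀^Fin (m + 1)]→ₗ[ℂ] ℂ,
      (∀ x, (O.canonicalX D).IsHol c x η ∧ η x ≠ 0) ∧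
      ∀ x, c.1.proj x.1 ∉ D → η x = s x.1 ^ α • Ω c x

/-- The isomorphism `ψ : (α - 1) N_D^* ≅ K_D` is given by the Poincaré residue of `Ω`: on each chart,
for each defining function `s` of `D` and each holomorphic extension `η` of `s^α Ω`, it maps
`ds^{⊗(α-1)}` at `z ∈ D̃` to the restriction to `T_z D̃` of the contraction `η ⌟ v = η(v, ·)`, where `v`
is any vector with `ds(v) = 1` (a representative of `∂/∂s` in the normal space). -/
def ComplexOrbifold.IsPoincareResidue {X : Type u} [TopologicalSpace X] {m : ℕ}
    (O : ComplexOrbifold X (m + 1)) (D : Set X) (α : ℕ) (Ω : O.FormFamily D)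
    (ψ : ((O.conormalD D).pow (α - 1)).Iso (O.canonicalD D)) : Prop :=
  ∀ (c : O.DivisorChart D) (s : Cn (m + 1) → ℂ), IsDefiningFunction c.1 D s →
    ∀ η : ∀ x : (O.ambientSystem D).carrier c,
      ((O.ambientSystem D).T c x) [⋀^Fin (m + 1)]→ₗ[ℂ] ℂ,
    (∀ x, (O.canonicalX D).IsHol c x η) →
    (∀ x, c.1.proj x.1 ∉ D → η x = s x.1 ^ α • Ω c x) →
    ∀ (z : (O.suborbifoldSystem D).carrier c) (ν : ((O.suborbifoldSystem D).T c z).dualAnnihilator),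
    (∀ w, ν.1 w = fderiv ℂ s z.1 w) →
    ∀ v : (O.ambientSystem D).T c ⟨z.1, z.2.1⟩, fderiv ℂ s z.1 v.1 = 1 →
    ∀ t : Fin m → (O.suborbifoldSystem D).T c z,
      ChartSystem.evalForm (ψ.equiv c z (PiTensorProduct.tprod ℂ
          (s := fun _ : Fin (α - 1) => ((O.suborbifoldSystem D).T c z).dualAnnihilator) fun _ => ν)) t
        = η ⟨z.1, z.2.1⟩
          (Fin.cons v fun k => Submodule.inclusion (tangent_mono (fun _ h => h.1) z.1) (t k))

end OrbiAdj

/-!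
Dually to `-K_X ≅ α[D]`, the bundle `K_X` has nowhere vanishing local sections `η` with the cocycle
inverse to that of `α[D]`; as this cocycle is also the one by which `s^α` transforms, the form
`Ω = s^{-α} η` is independent of the chart.

A defining function `s` of `D` trivialises the conormal bundle by `ds`, and the contraction of the
nowhere vanishing form `s^α Ω` with `∂/∂s` trivialises `K_D`. If `s'` is another defining function
and `ds' = a ds` along `D`, comparing the leading terms of `s'^α (s^α Ω) = s^α (s'^α Ω)` on a line
transverse to `D` gives `s'^α Ω = a^α s^α Ω` along `D`. Since `∂/∂s'` is `a⁻¹ ∂/∂s` modulo vectors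
tangent to `D`, the residue is multiplied by `a^(α - 1)`, exactly as `ds^{⊗(α - 1)}` is. The two
trivialisations therefore have the same cocycle, and mapping one to the other is an isomorphism.
-/

namespace OrbiAdj

universe u

section LinearAlgebra

variable {K V W N : Type*} [Field K] [AddCommGroup V] [Module K V] [AddCommGroup W] [Module K W]
  [AddCommGroup N] [Module K N]

theorem exists_linearEquiv_apply_eq (hV : Module.finrank K V = 1) (hW : Module.finrank K W = 1)
    {v : V} {w : W} (hv : v ≠ 0) (hw : w ≠ 0) : ∃ φ : V ≃ₗ[K] W, φ v = w := by
  let b := FiniteDimensional.basisSingleton Unit hV v hv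
  let b' := FiniteDimensional.basisSingleton Unit hW w hw
  refine ⟨b.equiv b' (Equiv.refl Unit), ?_⟩
  simpa only [b, b', FiniteDimensional.basisSingleton_apply] using
    b.equiv_apply () b' (Equiv.refl Unit)

theorem alternatingMap_eq_zero_of_finrank_lt [FiniteDimensional K W] {ι : Type*} [Fintype ι]
    (h : Module.finrank K W < Fintype.card ι) (f : W [⋀^ι]→ₗ[K] N) : f = 0 :=
  AlternatingMap.ext fun w => f.map_linearDependent w fun hw =>
    h.not_ge hw.fintype_card_le_finrank

theorem curryLeft_apply_compLinearMap_eq_zero [FiniteDimensional K W] {m : ℕ}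
    (h : Module.finrank K W < m + 1) (f : V [⋀^Fin (m + 1)]→ₗ[K] N) (g : W →ₗ[K] V) (w : W) :
    (f.curryLeft (g w)).compLinearMap g = 0 := by
  rw [← AlternatingMap.curryLeft_compLinearMap,
    alternatingMap_eq_zero_of_finrank_lt (by rwa [Fintype.card_fin]) (f.compLinearMap g),
    AlternatingMap.curryLeft_zero, LinearMap.zero_apply]

theorem curryLeft_compLinearMap_ne_zero [FiniteDimensional K W] {m : ℕ}
    (hW : Module.finrank K W = m) (hV : Module.finrank K V = m + 1)
    {f : V [⋀^Fin (m + 1)]→ₗ[K] K} (hf : f ≠ 0) {g : W →ₗ[K] V} (hg : Function.Injective g) {v : V}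
    (hv : v ∉ LinearMap.range g) : (f.curryLeft v).compLinearMap g ≠ 0 := by
  intro h
  let b := Module.finBasisOfFinrankEq K W hW
  have hspan : Submodule.span K (Set.range (g ∘ b)) = LinearMap.range g := by
    rw [Set.range_comp, Submodule.span_image, b.span_eq, Submodule.map_top]
  have hli : LinearIndependent K (Fin.cons v (g ∘ b) : Fin (m + 1) → V) :=
    linearIndependent_finCons.2
      ⟨b.linearIndependent.map' g (LinearMap.ker_eq_bot.2 hg), by rwa [hspan]⟩
  refine hf ((f.map_basis_eq_zero_iff
    (basisOfLinearIndependentOfCardEqFinrank hli (by rw [Fintype.card_fin, hV]))).1 ?_)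
  rw [coe_basisOfLinearIndependentOfCardEqFinrank]
  exact AlternatingMap.congr_fun h b

theorem tprod_ne_zero {ι : Type*} [Finite ι] {M : ι → Type*} [∀ i, AddCommGroup (M i)]
    [∀ i, Module K (M i)] {v : ∀ i, M i} (hv : ∀ i, v i ≠ 0) : PiTensorProduct.tprod K v ≠ 0 := by
  intro h
  cases nonempty_fintype ι
  choose φ hφ using fun i => Module.Projective.exists_dual_eq_one K (hv i)
  have hlift := congrArg (PiTensorProduct.lift
    ((MultilinearMap.mkPiAlgebra K ι K).compLinearMap φ)) h
  simp [hφ] at hlift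

theorem tprod_const_smul {R M ι : Type*} [CommSemiring R] [AddCommMonoid M] [Module R M]
    [Fintype ι] (a : R) (v : M) :
    (PiTensorProduct.tprod R fun _ : ι => a • v)
      = a ^ Fintype.card ι • PiTensorProduct.tprod R fun _ : ι => v := by
  rw [MultilinearMap.map_smul_univ _ (fun _ => a) fun _ => v, Finset.prod_const,
    Finset.card_univ]

end LinearAlgebra

theorem pow_smul_eq_of_eventually_eq {𝕜 E F : Type*} [NontriviallyNormedField 𝕜]
    [NormedAddCommGroup E] [NormedSpace 𝕜 E] [NormedAddCommGroup F] [NormedSpace 𝕜 F]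
    {f g : E → 𝕜} {p q : E → F} {x v : E} {f' g' : 𝕜} (hf : HasLineDerivAt 𝕜 f f' x v)
    (hg : HasLineDerivAt 𝕜 g g' x v) (hf0 : f x = 0) (hg0 : g x = 0) (hp : ContinuousAt p x)
    (hq : ContinuousAt q x) (k : ℕ) (h : ∀ᶠ y in 𝓝 x, f y ^ k • p y = g y ^ k • q y) :
    f' ^ k • p x = g' ^ k • q x := by
  have hline : Tendsto (fun t : 𝕜 => x + t • v) (𝓝[≠] 0) (𝓝 x) := by
    have hcont : Continuous fun t : 𝕜 => x + t • v := by fun_prop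
    simpa using (hcont.tendsto 0).mono_left nhdsWithin_le_nhds
  have hlim : ∀ {f : E → 𝕜} {p : E → F} {f' : 𝕜}, HasLineDerivAt 𝕜 f f' x v → f x = 0 →
      ContinuousAt p x →
      Tendsto (fun t : 𝕜 => t⁻¹ ^ k • f (x + t • v) ^ k • p (x + t • v)) (𝓝[≠] 0)
        (𝓝 (f' ^ k • p x)) := by
    intro f p f' hf hf0 hp
    refine ((hf.tendsto_slope_zero.pow k).smul (hp.tendsto.comp hline)).congr fun t => ?_
    rw [hf0, sub_zero, smul_eq_mul, mul_pow, mul_smul, Function.comp_apply]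
  refine tendsto_nhds_unique ((hlim hf hf0 hp).congr' ?_) (hlim hg hg0 hq)
  filter_upwards [hline.eventually h] with t ht
  rw [ht]

theorem ChartSystem.HolFun.eventually_ne {n d : ℕ} {S : ChartSystem.{u} n d} {i : S.Chart}
    {x : S.carrier i} {u : S.carrier i → ℂ} (h : S.HolFun i x u) (h0 : u x ≠ 0) :
    ∀ᶠ y in 𝓝 x, u y ≠ 0 := by
  obtain ⟨f, hf, hu⟩ := h
  have hfx : f x.1 ≠ 0 := by rwa [← hu.self_of_nhds]
  filter_upwards [hu, continuousAt_subtype_val.eventually (hf.continuousAt.eventually_ne hfx)]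
    with y hy hfy
  rwa [hy]

namespace LineOrbibundle

variable {n d : ℕ} {S : ChartSystem.{u} n d} {i j : S.Chart} {L L' : LineOrbibundle S}

theorem finrank_fiber (L : LineOrbibundle S) (i : S.Chart) (x : S.carrier i) :
    Module.finrank ℂ (L.Fiber i x) = 1 := by
  obtain ⟨e, he, -⟩ := L.exists_frame i x
  obtain ⟨h0, hspan⟩ := he.self_of_nhds
  exact (finrank_eq_one_iff_of_nonzero' _ h0).2 fun v => (hspan v).imp fun _ h => h.symm

theorem exists_eq_smul {x : S.carrier i} {e : L.Fiber i x} (he : e ≠ 0) (v : L.Fiber i x) :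
    ∃ a : ℂ, v = a • e :=
  ((finrank_eq_one_iff_of_nonzero' e he).1 (L.finrank_fiber i x) v).imp fun _ h => h.symm

theorem IsHol.smul {x : S.carrier i} {σ : ∀ y, L.Fiber i y} (hσ : L.IsHol i x σ)
    {u : S.carrier i → ℂ} (hu : S.HolFun i x u) : L.IsHol i x (fun y => u y • σ y) := by
  obtain ⟨e, -, he⟩ := L.exists_frame i x
  obtain ⟨w, hw, hσw⟩ := (he.self_of_nhds σ).1 hσ
  refine (he.self_of_nhds _).2 ⟨_, hu.mul hw, ?_⟩
  filter_upwards [hσw] with y hy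
  rw [hy, smul_smul]

theorem IsHol.congr {x : S.carrier i} {σ τ : ∀ y, L.Fiber i y} (hσ : L.IsHol i x σ)
    (h : ∀ᶠ y in 𝓝 x, σ y = τ y) : L.IsHol i x τ := by
  obtain ⟨e, -, he⟩ := L.exists_frame i x
  obtain ⟨w, hw, hσw⟩ := (he.self_of_nhds σ).1 hσ
  refine (he.self_of_nhds _).2 ⟨w, hw, ?_⟩
  filter_upwards [h, hσw] with y hy hσy
  rw [← hy, hσy]

theorem IsHol.isHol_iff_of_ne_zero {x : S.carrier i} {e σ : ∀ y, L.Fiber i y}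
    (he : L.IsHol i x e) (h0 : e x ≠ 0) :
    L.IsHol i x σ ↔ ∃ u, S.HolFun i x u ∧ ∀ᶠ y in 𝓝 x, σ y = u y • e y := by
  refine ⟨fun hσ => ?_, fun ⟨u, hu, h⟩ => (he.smul hu).congr (h.mono fun _ => Eq.symm)⟩
  obtain ⟨f, -, hf⟩ := L.exists_frame i x
  obtain ⟨w, hw, hew⟩ := (hf.self_of_nhds e).1 he
  obtain ⟨u, hu, hσu⟩ := (hf.self_of_nhds σ).1 hσ
  have hw0 : w x ≠ 0 := fun h => h0 (by rw [hew.self_of_nhds, h, zero_smul])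
  refine ⟨_, hu.mul (hw.inv hw0), ?_⟩
  filter_upwards [hew, hσu, hw.eventually_ne hw0] with y hey hσy hwy
  rw [hey, hσy, smul_smul, inv_mul_cancel_right₀ hwy]

theorem Iso.equiv_smul (ψ : L.Iso L') (x : S.carrier i) (a : ℂ) (v : L.Fiber i x) :
    ψ.equiv i x (a • v) = a • ψ.equiv i x v :=
  map_smul _ _ _

theorem Iso.ext_of_ne_zero {ψ ψ' : L.Iso L'} {e : ∀ i y, L.Fiber i y} (h0 : ∀ i y, e i y ≠ 0)
    (h : ∀ i y, ψ.equiv i y (e i y) = ψ'.equiv i y (e i y)) : ψ = ψ' := by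
  have heq : ψ.equiv = ψ'.equiv := by
    funext i x
    refine LinearEquiv.ext fun v => ?_
    obtain ⟨a, rfl⟩ := exists_eq_smul (h0 i x) v
    rw [ψ.equiv_smul, ψ'.equiv_smul, h]
  cases ψ
  cases ψ'
  cases heq
  rfl

/-- The inverse of an isomorphism of line orbibundles. -/
def Iso.symm (ψ : L.Iso L') : L'.Iso L where
  equiv i x := (ψ.equiv i x).symm
  isHol_iff i x σ := by simp only [ψ.isHol_iff, LinearEquiv.apply_symm_apply]
  pull_comm l x v := by
    rw [LinearEquiv.symm_apply_eq, ψ.pull_comm, LinearEquiv.apply_symm_apply]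

/-- A trivialisation of the line orbibundle `L` over every chart by a nowhere vanishing holomorphic
section `e i`, together with the cocycle `a` by which these sections transform under injections. -/
structure IsCocycleFrame (L : LineOrbibundle S) (e : ∀ i y, L.Fiber i y)
    (a : ∀ ⦃i j⦄, S.Inj i j → S.carrier i → ℂ) : Prop where
  isHol : ∀ i x, L.IsHol i x (e i)
  ne_zero : ∀ i x, e i x ≠ 0
  pull_eq : ∀ ⦃i j⦄ (l : S.Inj i j) (x : S.carrier i),
    L.pull l x (e j (ChartSystem.app l x)) = a l x • e i x

theorem exists_isCocycleFrame {e : ∀ i y, L.Fiber i y} (he : ∀ i x, L.IsHol i x (e i))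
    (h0 : ∀ i x, e i x ≠ 0) : ∃ a, L.IsCocycleFrame e a := by
  choose a ha using fun i j (l : S.Inj i j) (x : S.carrier i) =>
    exists_eq_smul (h0 i x) (L.pull l x (e j (ChartSystem.app l x)))
  exact ⟨a, he, h0, ha⟩

namespace IsCocycleFrame

variable {e : ∀ i y, L.Fiber i y} {a : ∀ ⦃i j⦄, S.Inj i j → S.carrier i → ℂ}

theorem map (h : L.IsCocycleFrame e a) (ψ : L.Iso L') :
    L'.IsCocycleFrame (fun i y => ψ.equiv i y (e i y)) a where
  isHol i x := (ψ.isHol_iff i x _).1 (h.isHol i x)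
  ne_zero i x := (ψ.equiv i x).map_ne_zero_iff.2 (h.ne_zero i x)
  pull_eq i j l x := by rw [← ψ.pull_comm, h.pull_eq, ψ.equiv_smul]

theorem tprod (h : L.IsCocycleFrame e a) (k : ℕ) :
    (L.pow k).IsCocycleFrame (fun i y => PiTensorProduct.tprod ℂ fun _ : Fin k => e i y)
      (fun _ _ l x => a l x ^ k) where
  isHol i x := ⟨fun _ => 1, fun _ => e i, .const 1, fun _ => h.isHol i x,
    Eventually.of_forall fun _ => (one_smul _ _).symm⟩
  ne_zero i x := tprod_ne_zero fun _ => h.ne_zero i x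
  pull_eq i j l x := by
    refine (PiTensorProduct.congr_tprod _ _).trans ?_
    simp only [h.pull_eq l x]
    exact (tprod_const_smul (ι := Fin k) (a l x) (e i x)).trans (by rw [Fintype.card_fin]; rfl)

theorem existsUnique_iso (h : L.IsCocycleFrame e a) {e' : ∀ i y, L'.Fiber i y}
    (h' : L'.IsCocycleFrame e' a) : ∃! ψ : L.Iso L', ∀ i x, ψ.equiv i x (e i x) = e' i x := by
  choose φ hφ using fun i x => exists_linearEquiv_apply_eq (L.finrank_fiber i x)
    (L'.finrank_fiber i x) (h.ne_zero i x) (h'.ne_zero i x)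
  refine ⟨⟨φ, fun i x σ => ?_, fun {i j} l x v => ?_⟩, hφ, fun ψ hψ =>
    Iso.ext_of_ne_zero h.ne_zero fun i x => (hψ i x).trans (hφ i x).symm⟩
  · simp only [(h.isHol i x).isHol_iff_of_ne_zero (h.ne_zero i x),
      (h'.isHol i x).isHol_iff_of_ne_zero (h'.ne_zero i x), ← hφ, ← map_smul,
      EmbeddingLike.apply_eq_iff_eq]
  · obtain ⟨b, rfl⟩ := exists_eq_smul (h.ne_zero j _) v
    simp only [map_smul, h.pull_eq, hφ, h'.pull_eq]

end IsCocycleFrame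

theorem isHol_of_dual_apply_eq_one {x : S.carrier i} {δ : ∀ y, Module.Dual ℂ (L.Fiber i y)}
    (hδ : L.dual.IsHol i x δ) {η : ∀ y, L.Fiber i y} (hη : ∀ y, δ y (η y) = 1) :
    L.IsHol i x η := by
  obtain ⟨e, he⟩ : ∃ e, L.IsFrame i x e := L.exists_frame i x
  have hη0 : ∀ y, η y ≠ 0 := fun y h => by simpa [h] using hη y
  have he_eq : ∀ y, e y = δ y (e y) • η y := fun y => by
    obtain ⟨a, ha⟩ := exists_eq_smul (hη0 y) (e y)
    rw [ha, map_smul, hη, smul_eq_mul, mul_one]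
  have hhol : S.HolFun i x fun y => δ y (e y) := Eventually.self_of_nhds hδ e he.isHol
  have hne : δ x (e x) ≠ 0 := fun h =>
    he.1.self_of_nhds.1 (by rw [he_eq x, h, zero_smul])
  refine (he.isHol.smul (hhol.inv hne)).congr ?_
  filter_upwards [hhol.eventually_ne hne] with y hy
  rw [inv_smul_eq_iff₀ hy]
  exact he_eq y

theorem pull_eq_inv_smul_of_dual (l : S.Inj i j) (x : S.carrier i) {a : ℂ}
    {δ : Module.Dual ℂ (L.Fiber i x)} {δ' : Module.Dual ℂ (L.Fiber j (ChartSystem.app l x))}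
    (hδ : L.dual.pull l x δ' = a • δ) {v : L.Fiber i x} {v' : L.Fiber j (ChartSystem.app l x)}
    (hv : δ v = 1) (hv' : δ' v' = 1) : L.pull l x v' = a⁻¹ • v := by
  have hv0 : v ≠ 0 := fun h => by simp [h] at hv
  obtain ⟨b, hb⟩ := exists_eq_smul hv0 (L.pull l x v')
  have hpair : δ' ((L.pull l x).symm (L.pull l x v')) = a * δ (L.pull l x v') :=
    LinearMap.congr_fun hδ _
  rw [LinearEquiv.symm_apply_apply, hv', hb, map_smul, hv, smul_eq_mul, mul_one] at hpair
  rw [hb, eq_inv_of_mul_eq_one_right hpair.symm]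

theorem IsCocycleFrame.exists_of_dual {δ : ∀ i y, Module.Dual ℂ (L.Fiber i y)}
    {a : ∀ ⦃i j⦄, S.Inj i j → S.carrier i → ℂ} (h : L.dual.IsCocycleFrame δ a) :
    ∃ η, L.IsCocycleFrame η fun _ _ l x => (a l x)⁻¹ := by
  choose η hη using fun i y => LinearMap.surjective (h.ne_zero i y) (1 : ℂ)
  exact ⟨η, fun i x => isHol_of_dual_apply_eq_one (h.isHol i x) (hη i),
    fun i y h0 => by simpa [h0] using hη i y,
    fun i j l x => pull_eq_inv_smul_of_dual l x (h.pull_eq l x) (hη i x) (hη j _)⟩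

end LineOrbibundle

section DefiningFunctions

variable {X : Type u} [TopologicalSpace X] {n : ℕ} {c c' : OrbiChart X n} {D : Set X}
  {s : Cn n → ℂ}

theorem IsDefiningFunction.exists_fderiv_eq_one (hs : IsDefiningFunction c D s) {x : Cn n}
    (hx : x ∈ c.preimage D) : ∃ v, fderiv ℂ s x v = 1 :=
  LinearMap.surjective (f := (fderiv ℂ s x : Cn n →ₗ[ℂ] ℂ))
    (ContinuousLinearMap.coe_injective.ne (hs.fderiv_ne_zero x hx)) 1

theorem IsDefiningFunction.mem_tangent_iff (hs : IsDefiningFunction c D s) {x : Cn n}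
    (hx : x ∈ c.preimage D) {v : Cn n} :
    v ∈ tangent (c.preimage D) x ↔ fderiv ℂ s x v = 0 := by
  rw [tangent_preimage hs hx, LinearMap.mem_ker, ContinuousLinearMap.coe_coe]

theorem IsInjection.surjective_fderiv {l : Cn n → Cn n} (hl : IsInjection c c' l) {x : Cn n}
    (hx : x ∈ c.dom) : Function.Surjective (fderiv ℂ l x) :=
  LinearMap.injective_iff_surjective (f := (fderiv ℂ l x : Cn n →ₗ[ℂ] Cn n)).1
    (hl.injective_fderiv x hx)

theorem IsDefiningFunction.fderiv_comp_apply (hs : IsDefiningFunction c' D s) {l : Cn n → Cn n}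
    (hl : IsInjection c c' l) {x : Cn n} (hx : x ∈ c.dom) (v : Cn n) :
    fderiv ℂ (s ∘ l) x v = fderiv ℂ s (l x) (fderiv ℂ l x v) := by
  rw [fderiv_comp x (hs.holomorphic _ (hl.mapsTo hx)).differentiableAt
    (hl.holomorphic x hx).differentiableAt, ContinuousLinearMap.comp_apply]

theorem IsDefiningFunction.comp (hs : IsDefiningFunction c' D s) {l : Cn n → Cn n}
    (hl : IsInjection c c' l) : IsDefiningFunction c D (s ∘ l) where
  holomorphic x hx := (hs.holomorphic _ (hl.mapsTo hx)).comp (hl.holomorphic x hx)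
  zero_iff x hx := by rw [Function.comp_apply, hs.zero_iff _ (hl.mapsTo hx), hl.proj_comp x hx]
  fderiv_ne_zero x hx h0 := by
    have hlx : l x ∈ c'.preimage D := ⟨hl.mapsTo hx.1, by rw [hl.proj_comp x hx.1]; exact hx.2⟩
    obtain ⟨w, hw⟩ := hs.exists_fderiv_eq_one hlx
    obtain ⟨v, rfl⟩ := hl.surjective_fderiv hx.1 w
    rw [← hs.fderiv_comp_apply hl hx.1, h0] at hw
    exact zero_ne_one hw

end DefiningFunctions

namespace ComplexOrbifold

variable {X : Type u} [TopologicalSpace X] {m : ℕ} {O : ComplexOrbifold X (m + 1)} {D : Set X}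
  {α : ℕ} {c c' : O.DivisorChart D} {s s' : Cn (m + 1) → ℂ}

theorem mem_T_ambientSystem (x : (O.ambientSystem D).carrier c) (v : Cn (m + 1)) :
    v ∈ (O.ambientSystem D).T c x := by
  rw [show (O.ambientSystem D).T c x = ⊤ from tangent_of_isOpen c.1.isOpen_dom x.2]
  exact Submodule.mem_top

/-- A point of the preimage of `D` in a chart of `X`, as a point of that chart. -/
abbrev toAmbient (z : (O.suborbifoldSystem D).carrier c) : (O.ambientSystem D).carrier c :=
  ⟨z.1, z.2.1⟩

theorem continuous_toAmbient :
    Continuous (toAmbient : (O.suborbifoldSystem D).carrier c → (O.ambientSystem D).carrier c) :=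
  continuous_subtype_val.subtype_mk _

/-- The inclusion of the tangent space of `D` into the tangent space of `X`, in a chart. -/
abbrev tangentInclusion (z : (O.suborbifoldSystem D).carrier c) :
    (O.suborbifoldSystem D).T c z →ₗ[ℂ] (O.ambientSystem D).T c (toAmbient z) :=
  Submodule.inclusion (tangent_mono (fun _ h => h.1) z.1)

/-- The differential `ds` of a defining function `s` of `D` as a section of the conormal bundle. -/
noncomputable def conormalDifferential (hs : IsDefiningFunction c.1 D s)
    (z : (O.suborbifoldSystem D).carrier c) : ((O.suborbifoldSystem D).T c z).dualAnnihilator :=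
  ⟨(fderiv ℂ s z.1 : Cn (m + 1) →ₗ[ℂ] ℂ), (Submodule.mem_dualAnnihilator _).2
    fun _ hw => (hs.mem_tangent_iff z.2).1 hw⟩

theorem conormalDifferential_ne_zero (hs : IsDefiningFunction c.1 D s)
    (z : (O.suborbifoldSystem D).carrier c) : conormalDifferential hs z ≠ 0 := fun h =>
  hs.fderiv_ne_zero z.1 z.2 (ContinuousLinearMap.coe_injective (congrArg Subtype.val h))

theorem isHol_conormalDifferential (hs : IsDefiningFunction c.1 D s)
    (z : (O.suborbifoldSystem D).carrier c) :
    (O.conormalD D).IsHol c z (conormalDifferential hs) :=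
  ⟨fun y => (fderiv ℂ s y : Cn (m + 1) →ₗ[ℂ] ℂ),
    fun v => analyticAt_fderiv_apply (hs.holomorphic z.1 z.2.1) v,
    Eventually.of_forall fun _ => rfl⟩

theorem pull_conormalDifferential (l : (O.suborbifoldSystem D).Inj c c')
    (hs : IsDefiningFunction c'.1 D s) (z : (O.suborbifoldSystem D).carrier c) :
    (O.conormalD D).pull l z (conormalDifferential hs (ChartSystem.app l z))
      = conormalDifferential (hs.comp l.2) z :=
  Subtype.ext (LinearMap.ext fun v => (hs.fderiv_comp_apply l.2 z.2.1 v).symm)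

theorem exists_conormalDifferential_eq_smul (hs : IsDefiningFunction c.1 D s)
    (hs' : IsDefiningFunction c.1 D s') (z : (O.suborbifoldSystem D).carrier c) :
    ∃ a : ℂ, conormalDifferential hs' z = a • conormalDifferential hs z :=
  LineOrbibundle.exists_eq_smul (L := O.conormalD D) (x := z) (conormalDifferential_ne_zero hs z)
    (conormalDifferential hs' z)

theorem fderiv_apply_of_conormalDifferential_eq_smul {hs : IsDefiningFunction c.1 D s}
    {hs' : IsDefiningFunction c.1 D s'} {z : (O.suborbifoldSystem D).carrier c} {a : ℂ}
    (h : conormalDifferential hs' z = a • conormalDifferential hs z) (v : Cn (m + 1)) :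
    fderiv ℂ s' z.1 v = a * fderiv ℂ s z.1 v :=
  LinearMap.congr_fun (congrArg Subtype.val h) v

/-- A family of top-degree forms on the tangent spaces of a chart of `X`. -/
abbrev ChartForm (O : ComplexOrbifold X (m + 1)) (D : Set X) (c : O.DivisorChart D) : Type :=
  ∀ x : (O.ambientSystem D).carrier c, ((O.ambientSystem D).T c x) [⋀^Fin (m + 1)]→ₗ[ℂ] ℂ

variable {Ω : O.FormFamily D} {η η' : O.ChartForm D c}

/-- `η` is an extension of `s^α Ω` from the complement of `D` to a holomorphic form on the whole
chart `c`. -/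
structure IsHolomorphicExtension (α : ℕ) (Ω : O.FormFamily D) (c : O.DivisorChart D)
    (s : Cn (m + 1) → ℂ) (η : O.ChartForm D c) : Prop where
  isHol : ∀ x, (O.canonicalX D).IsHol c x η
  eq_smul : ∀ x, c.1.proj x.1 ∉ D → η x = s x.1 ^ α • Ω c x

theorem IsVolumeFormWithPole.isHolomorphicExtension_pull (hΩ : O.IsVolumeFormWithPole D α Ω)
    (l : (O.ambientSystem D).Inj c c') {η : O.ChartForm D c'}
    (h : IsHolomorphicExtension α Ω c' s η) :
    IsHolomorphicExtension α Ω c (s ∘ l.1)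
      (fun x => (O.canonicalX D).pull l x (η (ChartSystem.app l x))) where
  isHol x := (O.canonicalX D).isHol_pull l x η (h.isHol _)
  eq_smul x hx := by
    have hx' : c'.1.proj (ChartSystem.app l x).1 ∉ D := by
      rwa [IsInjection.proj_comp l.2 x.1 x.2]
    rw [← hΩ.pull_eq c c' l x hx]
    exact (congrArg ((O.canonicalX D).pull l x) (h.eq_smul _ hx')).trans
      (AlternatingMap.ext fun _ => rfl)

theorem IsHolomorphicExtension.pow_smul_eq (hα : α ≠ 0) (hs : IsDefiningFunction c.1 D s)
    (hs' : IsDefiningFunction c.1 D s') (h : IsHolomorphicExtension α Ω c s η)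
    (h' : IsHolomorphicExtension α Ω c s' η') (x : (O.ambientSystem D).carrier c) :
    s x.1 ^ α • η' x = s' x.1 ^ α • η x := by
  by_cases hx : c.1.proj x.1 ∈ D
  · rw [(hs.zero_iff x.1 x.2).2 hx, (hs'.zero_iff x.1 x.2).2 hx, zero_pow hα, zero_smul, zero_smul]
  · rw [h.eq_smul x hx, h'.eq_smul x hx, smul_comm]

theorem IsHolomorphicExtension.eq_pow_smul (hα : α ≠ 0) {hs : IsDefiningFunction c.1 D s}
    {hs' : IsDefiningFunction c.1 D s'} (h : IsHolomorphicExtension α Ω c s η)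
    (h' : IsHolomorphicExtension α Ω c s' η') {z : (O.suborbifoldSystem D).carrier c} {a : ℂ}
    (ha : conormalDifferential hs' z = a • conormalDifferential hs z) :
    η' (toAmbient z) = a ^ α • η (toAmbient z) := by
  refine AlternatingMap.ext fun t => ?_
  obtain ⟨H, hH, hηH⟩ := h.isHol (toAmbient z)
  obtain ⟨H', hH', hηH'⟩ := h'.isHol (toAmbient z)
  obtain ⟨v, hv⟩ := hs.exists_fderiv_eq_one z.2
  set w : Fin (m + 1) → Cn (m + 1) := fun k => (t k).1
  have hnear : ∀ᶠ y in 𝓝 z.1, s y ^ α • H' y w = s' y ^ α • H y w := by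
    rw [← c.1.isOpen_dom.nhdsWithin_eq z.2.1]
    refine (eventually_nhds_subtype_iff c.1.dom (toAmbient z)
      fun y => s y ^ α • H' y w = s' y ^ α • H y w).1 ?_
    filter_upwards [hηH, hηH'] with y hy hy'
    have heq := AlternatingMap.congr_fun (h.pow_smul_eq hα hs hs' h' y) fun k =>
      ⟨w k, mem_T_ambientSystem y _⟩
    rwa [AlternatingMap.smul_apply, AlternatingMap.smul_apply, hy, hy'] at heq
  have hline : ∀ {f}, IsDefiningFunction c.1 D f →
      HasLineDerivAt ℂ f (fderiv ℂ f z.1 v) z.1 v := fun hf =>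
    (hf.holomorphic z.1 z.2.1).differentiableAt.hasFDerivAt.hasLineDerivAt v
  have hzero : ∀ {f}, IsDefiningFunction c.1 D f → f z.1 = 0 := fun hf =>
    (hf.zero_iff z.1 z.2.1).2 z.2.2
  have hlead := pow_smul_eq_of_eventually_eq (hline hs) (hline hs') (hzero hs) (hzero hs')
    (hH' w).continuousAt (hH w).continuousAt α hnear
  rw [fderiv_apply_of_conormalDifferential_eq_smul ha, hv, one_pow, one_smul, mul_one] at hlead
  rw [AlternatingMap.smul_apply, hηH.self_of_nhds t, hηH'.self_of_nhds t]
  exact hlead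

/-- The Poincaré residue of `η / s^α` along `D`: the restriction to the tangent space of `D` of the
contraction of `η` with a vector `v` such that `ds(v) = 1`. The vector is chosen, see
`residue_eq`. -/
noncomputable def residue (hs : IsDefiningFunction c.1 D s) (η : O.ChartForm D c)
    (z : (O.suborbifoldSystem D).carrier c) :
    ((O.suborbifoldSystem D).T c z) [⋀^Fin m]→ₗ[ℂ] ℂ :=
  ((η (toAmbient z)).curryLeft
    ⟨(hs.exists_fderiv_eq_one z.2).choose, mem_T_ambientSystem _ _⟩).compLinearMap
      (tangentInclusion z)

theorem residue_eq (hs : IsDefiningFunction c.1 D s) (η : O.ChartForm D c)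
    (z : (O.suborbifoldSystem D).carrier c) (v : (O.ambientSystem D).T c (toAmbient z))
    (hv : fderiv ℂ s z.1 v.1 = 1) :
    residue hs η z = ((η (toAmbient z)).curryLeft v).compLinearMap (tangentInclusion z) := by
  obtain ⟨v₀, hv₀, hres⟩ : ∃ v₀ : (O.ambientSystem D).T c (toAmbient z),
      fderiv ℂ s z.1 v₀.1 = 1 ∧ residue hs η z =
        ((η (toAmbient z)).curryLeft v₀).compLinearMap (tangentInclusion z) :=
    ⟨⟨_, mem_T_ambientSystem _ _⟩, (hs.exists_fderiv_eq_one z.2).choose_spec, rfl⟩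
  have htangent : v₀.1 - v.1 ∈ (O.suborbifoldSystem D).T c z := by
    refine (hs.mem_tangent_iff z.2).2 ?_
    rw [map_sub, hv₀, hv, sub_self]
  have hv₀_eq : v₀ = v + tangentInclusion z ⟨_, htangent⟩ :=
    Subtype.ext (add_sub_cancel v.1 v₀.1).symm
  have hfinrank : Module.finrank ℂ ((O.suborbifoldSystem D).T c z) < m + 1 := by
    rw [ChartSystem.finrank_T z]
    exact Nat.lt_succ_self m
  rw [hres, hv₀_eq, map_add, AlternatingMap.add_compLinearMap,
    curryLeft_apply_compLinearMap_eq_zero hfinrank, add_zero]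

theorem residue_ne_zero (hs : IsDefiningFunction c.1 D s)
    {z : (O.suborbifoldSystem D).carrier c} (h0 : η (toAmbient z) ≠ 0) : residue hs η z ≠ 0 := by
  obtain ⟨v, hv⟩ := hs.exists_fderiv_eq_one z.2
  rw [residue_eq hs η z ⟨v, mem_T_ambientSystem _ _⟩ hv]
  refine curryLeft_compLinearMap_ne_zero (ChartSystem.finrank_T z)
    (ChartSystem.finrank_T (S := O.ambientSystem D) (toAmbient z)) h0
    (Submodule.inclusion_injective _) ?_
  rintro ⟨w, hw⟩
  have hwv : w.1 = v := congrArg Subtype.val hw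
  have hw0 := (hs.mem_tangent_iff z.2).1 w.2
  rw [hwv, hv] at hw0
  exact one_ne_zero hw0

theorem isHol_residue (hs : IsDefiningFunction c.1 D s)
    {z : (O.suborbifoldSystem D).carrier c} (hη : (O.canonicalX D).IsHol c (toAmbient z) η) :
    (O.canonicalD D).IsHol c z (residue hs η) := by
  obtain ⟨H, hH, hηH⟩ := hη
  obtain ⟨v, hv⟩ := hs.exists_fderiv_eq_one z.2
  have hds := analyticAt_fderiv_apply (hs.holomorphic z.1 z.2.1) v
  have hds0 : fderiv ℂ s z.1 v ≠ 0 := hv.symm ▸ one_ne_zero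
  refine ⟨fun y => (H y).curryLeft ((fderiv ℂ s y v)⁻¹ • v), fun w => ?_, ?_⟩
  · have hcons : ∀ k, AnalyticAt ℂ
        ((Fin.cons (fun y => (fderiv ℂ s y v)⁻¹ • v) fun k _ => w k :
          Fin (m + 1) → Cn (m + 1) → Cn (m + 1)) k) z.1 :=
      Fin.cases ((hds.inv hds0).smul analyticAt_const) fun _ => analyticAt_const
    exact (analyticAt_form H hH _ hcons).congr <| Eventually.of_forall fun y =>
      congrArg (H y) (funext (Fin.cases rfl fun _ => rfl))
  · filter_upwards [continuous_toAmbient.continuousAt.eventually hηH,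
      continuousAt_subtype_val.eventually (hds.continuousAt.eventually_ne hds0)] with y hy hy0
    have hy1 : fderiv ℂ s y.1 ((fderiv ℂ s y.1 v)⁻¹ • v) = 1 := by
      rw [map_smul, smul_eq_mul, inv_mul_cancel₀ hy0]
    rw [residue_eq hs η y ⟨(fderiv ℂ s y.1 v)⁻¹ • v, mem_T_ambientSystem _ _⟩ hy1]
    exact fun t => (hy _).trans (congrArg (H y.1) (funext (Fin.cases rfl fun _ => rfl)))

theorem residue_eq_pow_smul (hα : α ≠ 0) {hs : IsDefiningFunction c.1 D s}
    {hs' : IsDefiningFunction c.1 D s'}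
    (h : IsHolomorphicExtension α Ω c s η) (h' : IsHolomorphicExtension α Ω c s' η')
    {z : (O.suborbifoldSystem D).carrier c} {a : ℂ}
    (ha : conormalDifferential hs' z = a • conormalDifferential hs z) :
    residue hs' η' z = a ^ (α - 1) • residue hs η z := by
  have ha0 : a ≠ 0 := fun h0 => conormalDifferential_ne_zero hs' z (by rw [ha, h0, zero_smul])
  obtain ⟨v, hv⟩ := hs.exists_fderiv_eq_one z.2
  let v' : (O.ambientSystem D).T c (toAmbient z) := ⟨v, mem_T_ambientSystem _ _⟩
  have hv' : fderiv ℂ s' z.1 (a⁻¹ • v') = 1 := by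
    rw [fderiv_apply_of_conormalDifferential_eq_smul ha, map_smul, hv, smul_eq_mul, mul_one,
      mul_inv_cancel₀ ha0]
  rw [residue_eq hs' η' z (a⁻¹ • v') hv', residue_eq hs η z v' hv, h.eq_pow_smul hα h' ha,
    map_smul, AlternatingMap.curryLeft_smul, LinearMap.smul_apply, smul_smul,
    (inv_mul_eq_iff_eq_mul₀ ha0).2 (mul_pow_sub_one hα a).symm]
  rfl

theorem residue_pull (l : (O.suborbifoldSystem D).Inj c c') (hs : IsDefiningFunction c'.1 D s)
    (η : O.ChartForm D c') (z : (O.suborbifoldSystem D).carrier c) :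
    residue (hs.comp l.2) (fun x => (O.canonicalX D).pull (i := c) (j := c') l x
        (η (ChartSystem.app (S := O.ambientSystem D) l x))) z
      = (O.canonicalD D).pull l z (residue hs η (ChartSystem.app l z)) := by
  obtain ⟨v, hv⟩ := (hs.comp l.2).exists_fderiv_eq_one z.2
  have hlv : fderiv ℂ s (l.1 z.1) (fderiv ℂ l.1 z.1 v) = 1 := by
    rw [← hs.fderiv_comp_apply l.2 z.2.1, hv]
  refine (residue_eq (hs.comp l.2) _ z ⟨v, mem_T_ambientSystem _ _⟩ hv).trans <| Eq.trans ?_ <|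
    congrArg ((O.canonicalD D).pull l z)
      (residue_eq hs η (ChartSystem.app l z) ⟨fderiv ℂ l.1 z.1 v, mem_T_ambientSystem _ _⟩
        hlv).symm
  exact AlternatingMap.ext fun t => congrArg (η _) (funext (Fin.cases rfl fun _ => rfl))

theorem isVolumeFormWithPole_of_isCocycleFrame (Z : O.DivisorData D)
    {η : ∀ c, O.ChartForm D c}
    (hη : (O.canonicalX D).IsCocycleFrame η fun _ _ l x => (Z.ξ l x ^ α)⁻¹) :
    O.IsVolumeFormWithPole D α fun c x => (Z.f c x.1 ^ α)⁻¹ • η c x := by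
  have hf : ∀ c (x : (O.ambientSystem D).carrier c), c.1.proj x.1 ∉ D → Z.f c x.1 ^ α ≠ 0 :=
    fun c x hx => pow_ne_zero α (mt ((Z.isDefining c).zero_iff x.1 x.2).1 hx)
  have hf_hol : ∀ c (x : (O.ambientSystem D).carrier c),
      (O.ambientSystem D).HolFun c x fun y => Z.f c y.1 ^ α := fun c x =>
    ⟨fun y => Z.f c y ^ α, ((Z.isDefining c).holomorphic x.1 x.2).pow α,
      Eventually.of_forall fun _ => rfl⟩
  refine ⟨fun c x hx => (hη.isHol c x).smul ((hf_hol c x).inv (hf c x hx)),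
    fun c x hx => smul_ne_zero (inv_ne_zero (hf c x hx)) (hη.ne_zero c x),
    fun c c' l x _ => ?_, fun c => ⟨Z.f c, Z.isDefining c, η c,
      fun x => ⟨hη.isHol c x, hη.ne_zero c x⟩, fun x hx => (smul_inv_smul₀ (hf c x hx) _).symm⟩⟩
  refine (map_smul ((O.canonicalX D).pull l x) _ _).trans ?_
  rw [hη.pull_eq l x, Z.f_eq l x, mul_pow, mul_inv, mul_comm]
  exact smul_smul _ _ (η c x)

theorem AnticanonicalEq.exists_isVolumeFormWithPole (h : O.AnticanonicalEq D α) :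
    ∃ Ω : O.FormFamily D, O.IsVolumeFormWithPole D α Ω := by
  obtain ⟨Z, ⟨Φ⟩⟩ := h
  have hZ : Z.lineOrbibundle.IsCocycleFrame (fun _ _ => (1 : ℂ)) (fun _ _ => Z.ξ) :=
    ⟨fun _ _ => ChartSystem.HolFun.const 1, fun _ _ => one_ne_zero (α := ℂ), fun _ _ _ _ => rfl⟩
  obtain ⟨η, hη⟩ := ((hZ.tprod α).map Φ.symm).exists_of_dual
  exact ⟨_, isVolumeFormWithPole_of_isCocycleFrame Z hη⟩

theorem isPoincareResidue_iff (hα : α ≠ 0) {s : O.DivisorChart D → Cn (m + 1) → ℂ}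
    (hs : ∀ c, IsDefiningFunction c.1 D (s c)) {η : ∀ c, O.ChartForm D c}
    (hη : ∀ c, IsHolomorphicExtension α Ω c (s c) (η c))
    (ψ : ((O.conormalD D).pow (α - 1)).Iso (O.canonicalD D)) :
    O.IsPoincareResidue D α Ω ψ ↔
      ∀ (c : (O.suborbifoldSystem D).Chart) (z : (O.suborbifoldSystem D).carrier c),
        ψ.equiv c z (PiTensorProduct.tprod ℂ fun _ : Fin (α - 1) => conormalDifferential (hs c) z)
          = residue (hs c) (η c) z := by
  constructor
  · intro h c z
    obtain ⟨v, hv⟩ := (hs c).exists_fderiv_eq_one z.2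
    rw [residue_eq (hs c) (η c) z ⟨v, mem_T_ambientSystem _ _⟩ hv]
    exact AlternatingMap.ext fun t => h c (s c) (hs c) (η c) (hη c).isHol (hη c).eq_smul z _
      (fun _ => rfl) ⟨v, mem_T_ambientSystem _ _⟩ hv t
  · intro h c s' hs' η' hη' hηΩ' z ν hν v hv t
    obtain rfl : ν = conormalDifferential hs' z := Subtype.ext (LinearMap.ext hν)
    obtain ⟨a, ha⟩ := exists_conormalDifferential_eq_smul (hs c) hs' z
    refine Eq.trans ?_ (AlternatingMap.congr_fun (residue_eq hs' η' z v hv) t)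
    rw [residue_eq_pow_smul hα (hη c) ⟨hη', hηΩ'⟩ ha, ha, tprod_const_smul, Fintype.card_fin]
    refine congrArg (fun f => ChartSystem.evalForm (S := O.suborbifoldSystem D) f t) ?_
    refine (ψ.equiv_smul z (a ^ (α - 1)) _).trans ?_
    exact congrArg (fun f : ((O.suborbifoldSystem D).T c z) [⋀^Fin m]→ₗ[ℂ] ℂ => a ^ (α - 1) • f)
      (h c z)

theorem IsVolumeFormWithPole.existsUnique_isPoincareResidue (hα : α ≠ 0)
    (hΩ : O.IsVolumeFormWithPole D α Ω) :
    ∃! ψ : ((O.conormalD D).pow (α - 1)).Iso (O.canonicalD D), O.IsPoincareResidue D α Ω ψ := by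
  choose s hs η hη hηΩ using hΩ.pole
  have hext : ∀ c, IsHolomorphicExtension α Ω c (s c) (η c) := fun c =>
    ⟨fun x => (hη c x).1, hηΩ c⟩
  obtain ⟨a, hds⟩ := LineOrbibundle.exists_isCocycleFrame (L := O.conormalD D)
    (fun c z => isHol_conormalDifferential (hs c) z)
    (fun c z => conormalDifferential_ne_zero (hs c) z)
  have hres : (O.canonicalD D).IsCocycleFrame (fun c z => residue (hs c) (η c) z)
      fun _ _ l z => a l z ^ (α - 1) :=
    ⟨fun c z => isHol_residue (hs c) (hη c _).1, fun c z => residue_ne_zero (hs c) (hη c _).2,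
      fun c c' l z => (residue_pull l (hs c') (η c') z).symm.trans <|
        residue_eq_pow_smul hα (hext c) (hΩ.isHolomorphicExtension_pull l (hext c')) <|
          (pull_conormalDifferential l (hs c') z).symm.trans (hds.pull_eq l z)⟩
  simpa only [isPoincareResidue_iff hα hs hext] using (hds.tprod (α - 1)).existsUnique_iso hres

end ComplexOrbifold

end OrbiAdj

theorem proposition2p1_general {X : Type*} [TopologicalSpace X] {m : ℕ}
    (O : OrbiAdj.ComplexOrbifold X (m + 1)) (D : Set X) (α : ℕ) (hα : α ≠ 0)
    (hanti : O.AnticanonicalEq D α) :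
    Nonempty ((O.canonicalD D).Iso ((O.conormalD D).pow (α - 1))) ∧
    (∃ Ω : O.FormFamily D, O.IsVolumeFormWithPole D α Ω) ∧
    ∀ Ω : O.FormFamily D, O.IsVolumeFormWithPole D α Ω →
      ∃! ψ : ((O.conormalD D).pow (α - 1)).Iso (O.canonicalD D), O.IsPoincareResidue D α Ω ψ := by
  obtain ⟨Ω, hΩ⟩ := hanti.exists_isVolumeFormWithPole
  obtain ⟨ψ, -, -⟩ := hΩ.existsUnique_isPoincareResidue hα
  exact ⟨⟨ψ.symm⟩, ⟨Ω, hΩ⟩, fun _ hΩ' => hΩ'.existsUnique_isPoincareResidue hα⟩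

theorem proposition2p1 {X : Type*} [TopologicalSpace X] [CompactSpace X] [T2Space X] {m : ℕ}
    (O : OrbiAdj.ComplexOrbifold X (m + 1)) (hK : ∃ g, O.IsKahlerMetric g)
    (D : Set X) (hD : O.IsSuborbifold D) (hconn : IsConnected D) (hsing : O.singularSet ⊆ D)
    (α : ℕ) (hα : 2 ≤ α) (hanti : O.AnticanonicalEq D α) (hbasic : O.BasicAssumption D α) :
    Nonempty ((O.canonicalD D).Iso ((O.conormalD D).pow (α - 1))) ∧
    (∃ Ω : O.FormFamily D, O.IsVolumeFormWithPole D α Ω) ∧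
    ∀ Ω : O.FormFamily D, O.IsVolumeFormWithPole D α Ω →
      ∃! ψ : ((O.conormalD D).pow (α - 1)).Iso (O.canonicalD D), O.IsPoincareResidue D α Ω ψ :=
  proposition2p1_general O D α (by omega) hanti
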